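/- Let $R=\mathbb F_q[[\pi]]$ with fraction field $K$, let $k$ be an algebraic closure of $\mathbb F_q$, and put $\mathcal R=k[[\pi]]$, $\mathcal K=k((\pi))$; let $\mathrm{Fr}_q$ denote the automorphism $\sum a_n\pi^n\mapsto\sum a_n^q\pi^n$ of $\mathcal R$ and of $\mathcal K$. For $d\ge 1$ let $D$ be the central division algebra over $K$ of dimension $d^2$ with invariant $1/d$ and $\mathcal D$ its maximal order, i.e. $\mathcal D=\mathbb F_{q^d}[[\Pi]]$ with $\Pi a=a^q\Pi$ for $a\in\mathbb F_{q^d}$ and $\Pi^d=\pi$, and $D=K\otimes_R\mathcal D$. Fix an $\mathbb F_q$-embedding $\mathbb F_{q^d}\hookrightarrow k$. A Dieudonné $\mathcal D$-module over $k$ is a pair $(M,\varphi)$, where $M$ is a free $\mathcal R$-module of rank $d^2$ with an $\mathcal R$-linear right action of $\mathcal D$ extending the action of $R$, and $\varphi:M\to M$ is an injective $\mathrm{Fr}_q$-linear map commuting with $\mathcal D$, with $\dim_k\mathrm{coker}(\varphi)<\infty$ and $\varphi^m(M)\subseteq\pi M$ for all large $m$. For $i\ge 0$ put $M_i=\{x\in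 M: x\lambda=\lambda^{q^i}x \text{ for all }\lambda\in\mathbb F_{q^d}\}$ (it depends only on $i$ modulo $d$); $\varphi$ restricts to $\varphi_i:M_i\to M_{i+1}$. The type of $(M,\varphi)$ is $\mathbf f=(f_0,\dots,f_{d-1})$ with $f_i=\dim_k\mathrm{coker}(\varphi_i)$, and $(M,\varphi)$ is exceptional if $\mathrm{Im}(\varphi)=\mathrm{Im}(\Pi)$. Let $\mathrm{End}_{\mathcal D}(M,\varphi)$ be the $R$-algebra, under composition, of $\mathcal R$-linear endomorphisms of $M$ commuting with $\varphi$ and $\mathcal D$, and $\mathrm{End}_D(N,\varphi)$ the $K$-algebra of $\mathcal K$-linear endomorphisms of $N=K\otimes_RM=\mathcal K\otimes_{\mathcal R}M$ commuting with $\varphi=\mathrm{Fr}_q\otimes\varphi$ and $D$. For a tuple $\mathbf f$ of non-negative integers with $\sum_i f_i=d$, let $\mathbb M_d(\mathbf f,R)\subseteq\mathbb M_d(R)$ be the ring of block matrices $(m_{ij})_{0\le i,j\le d-1}$, with $m_{ij}$ of size $f_i\times f_j$, whose blocks $m_{ij}$ with $i<j$ have all entries in $\pi R$. **Proposition.** Let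 $(M,\varphi)$ be an exceptional Dieudonné $\mathcal D$-module over $k$ of type $\mathbf f$. Then $\sum_i f_i=d$, and there are isomorphisms of $R$-algebras $$\mathrm{End}_{\mathcal D}(M,\varphi)\cong\mathbb M_d(\mathbf f,R)^{\mathrm{opp}}\cong\mathbb M_d\big((f_{d-1},\dots,f_0),R\big).$$ In particular, the natural map $\mathrm{End}_{\mathcal D}(M,\varphi)\to\mathrm{End}_D(N,\varphi)$ is injective and identifies $\mathrm{End}_{\mathcal D}(M,\varphi)$ with a hereditary $R$-order in $\mathrm{End}_D(N,\varphi)\cong\mathbb M_d(K)$: a subring that is a finitely generated $R$-module spanning $\mathrm{End}_D(N,\varphi)$ over $K$, all of whose left ideals and all of whose right ideals are projective. -/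

import Mathlib

open scoped PowerSeries TensorProduct
open MulOpposite

set_option linter.unusedSectionVars false

/-! ## Orders -/

/-- A ring is hereditary if all its left ideals and all its right ideals are projective modules. -/
def IsHereditaryRing (A : Type*) [Ring A] : Prop :=
  (∀ I : Ideal A, Module.Projective A I) ∧ ∀ I : Ideal Aᵐᵒᵖ, Module.Projective Aᵐᵒᵖ I

/-- An `R`-order in the `K`-algebra `A`: an `R`-subalgebra that is a full `R`-lattice in `A`. -/
structure IsOrder (R K : Type*) {A : Type*} [CommRing R] [Field K] [Ring A] [Algebra R A]
    [Algebra K A] (Λ : Subalgebra R A) : Prop where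
  finite : Module.Finite R Λ
  span_eq_top : Submodule.span K (Λ : Set A) = ⊤

/-- A hereditary `R`-order in the `K`-algebra `A`. -/
structure IsHereditaryOrder (R K : Type*) {A : Type*} [CommRing R] [Field K] [Ring A] [Algebra R A]
    [Algebra K A] (Λ : Subalgebra R A) : Prop extends IsOrder R K Λ where
  hereditary : IsHereditaryRing Λ

/-- The ring `𝕄_d(f, R)` of block matrices `(m_ij)` over `R` whose block `m_ij` has size
`f i × f j` and has all its entries in `ϖ R` if `i < j`.  The rows and columns are indexed by the
pairs `(i, s)` with `s < f i`; there are `∑ i, f i` of them. -/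
def stdHereditaryOrder {R : Type*} [CommRing R] (ϖ : R) {d : ℕ} (f : Fin d → ℕ) :
    Subalgebra R (Matrix (Σ i : Fin d, Fin (f i)) (Σ i : Fin d, Fin (f i)) R) where
  carrier := {m | ∀ a b, a.1 < b.1 → m a b ∈ Ideal.span {ϖ}}
  mul_mem' {m n} hm hn := by
    intro a b hab
    rw [Matrix.mul_apply]
    refine Ideal.sum_mem _ fun c _ => ?_
    rcases lt_or_ge a.1 c.1 with h | h
    · exact Ideal.mul_mem_right _ _ (hm a c h)
    · exact Ideal.mul_mem_left _ _ (hn c b (lt_of_le_of_lt h hab))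
  add_mem' {m n} hm hn := fun a b hab => Ideal.add_mem _ (hm a b hab) (hn a b hab)
  algebraMap_mem' r := by
    intro a b hab
    have : a ≠ b := fun h => by simp [h] at hab
    rw [Matrix.algebraMap_matrix_apply, if_neg this]
    exact Ideal.zero_mem _

/-! ## The maximal order of the division algebra with invariant `1 / d` -/

/-- The maximal order `𝒟 = 𝔽_{q^d}⟦Π⟧`: formal power series `∑ aₙ Πⁿ` with `aₙ ∈ 𝔽_{q^d}`, multiplied
by the rule `Π a = a ^ q Π`.  The uniformizer `π` of `R = 𝔽_q⟦π⟧` is `Π ^ d`, so this is the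
same as `R_d⟦Π⟧` with `R_d = 𝔽_{q^d}⟦π⟧` and `Π ^ d = π`. -/
def MaxOrd (_Fq Fqd : Type*) : Type _ := ℕ → Fqd

namespace MaxOrd

variable {Fq Fqd : Type*} [Field Fq] [Fintype Fq] [Field Fqd] [Algebra Fq Fqd]

/-- The `n`-th coefficient. -/
def coeff (a : MaxOrd Fq Fqd) (n : ℕ) : Fqd := a n

/-- The series with given coefficients. -/
def mk (a : ℕ → Fqd) : MaxOrd Fq Fqd := a

@[simp] theorem coeff_mk (a : ℕ → Fqd) (n : ℕ) : (mk a : MaxOrd Fq Fqd).coeff n = a n := rfl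

@[ext] theorem ext {a b : MaxOrd Fq Fqd} (h : ∀ n, a.coeff n = b.coeff n) : a = b := funext h

instance : AddCommGroup (MaxOrd Fq Fqd) := inferInstanceAs (AddCommGroup (ℕ → Fqd))

@[simp] theorem coeff_add (a b : MaxOrd Fq Fqd) (n : ℕ) :
    (a + b).coeff n = a.coeff n + b.coeff n := rfl

@[simp] theorem coeff_zero (n : ℕ) : (0 : MaxOrd Fq Fqd).coeff n = 0 := rfl

/-- `(∑ aᵢ Πⁱ) (∑ bⱼ Πʲ) = ∑ aᵢ bⱼ ^ (q ^ i) Πⁱ⁺ʲ`. -/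
instance : Mul (MaxOrd Fq Fqd) :=
  ⟨fun a b => mk fun n => ∑ p ∈ Finset.HasAntidiagonal.antidiagonal n,
    a.coeff p.1 * (FiniteField.frobeniusAlgHom Fq Fqd ^ p.1) (b.coeff p.2)⟩

instance : One (MaxOrd Fq Fqd) := ⟨mk fun n => if n = 0 then 1 else 0⟩

theorem coeff_mul (a b : MaxOrd Fq Fqd) (n : ℕ) :
    (a * b).coeff n = ∑ p ∈ Finset.HasAntidiagonal.antidiagonal n,
      a.coeff p.1 * (FiniteField.frobeniusAlgHom Fq Fqd ^ p.1) (b.coeff p.2) := rfl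

theorem coeff_one (n : ℕ) : (1 : MaxOrd Fq Fqd).coeff n = if n = 0 then 1 else 0 := rfl

instance : Ring (MaxOrd Fq Fqd) :=
  { (inferInstance : AddCommGroup (MaxOrd Fq Fqd)),
    (inferInstance : Mul (MaxOrd Fq Fqd)), (inferInstance : One (MaxOrd Fq Fqd)) with
    left_distrib := fun a b c => by
      ext n; simp [coeff_mul, mul_add, Finset.sum_add_distrib]
    right_distrib := fun a b c => by
      ext n; simp [coeff_mul, add_mul, Finset.sum_add_distrib]
    zero_mul := fun a => by ext n; simp [coeff_mul]
    mul_zero := fun a => by ext n; simp [coeff_mul]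
    one_mul := fun a => by
      ext n
      rw [coeff_mul, Finset.sum_eq_single (0, n)]
      · simp [coeff_one]
      · rintro ⟨i, j⟩ h hne
        have : i ≠ 0 := by
          rintro rfl
          simp_all
        simp [coeff_one, this]
      · simp
    mul_one := fun a => by
      ext n
      rw [coeff_mul, Finset.sum_eq_single (n, 0)]
      · simp [coeff_one]
      · rintro ⟨i, j⟩ h hne
        have : j ≠ 0 := by
          rintro rfl
          simp_all
        simp [coeff_one, this]
      · simp
    mul_assoc := fun a b c => by
      ext n
      simp only [coeff_mul, Finset.sum_mul, Finset.mul_sum, Finset.sum_sigma', map_sum, map_mul]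
      apply Finset.sum_nbij' (fun ⟨⟨_i, j⟩, ⟨k, l⟩⟩ ↦ ⟨(k, l + j), (l, j)⟩)
        (fun ⟨⟨i, _j⟩, ⟨k, l⟩⟩ ↦ ⟨(i + k, l), (i, k)⟩)
      · rintro ⟨⟨i, j⟩, ⟨k, l⟩⟩ h
        simp at h ⊢; omega
      · rintro ⟨⟨i, j⟩, ⟨k, l⟩⟩ h
        simp at h ⊢; omega
      · rintro ⟨⟨i, j⟩, ⟨k, l⟩⟩ h
        simp at h ⊢; omega
      · rintro ⟨⟨i, j⟩, ⟨k, l⟩⟩ h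
        simp at h ⊢; omega
      · rintro ⟨⟨i, j⟩, ⟨k, l⟩⟩ h
        simp only [Finset.mem_sigma, Finset.HasAntidiagonal.mem_antidiagonal] at h
        rw [← h.2, pow_add, AlgHom.mul_apply, mul_assoc] }

/-- The constant series `a`, for `a ∈ 𝔽_{q^d}`. -/
def const (a : Fqd) : MaxOrd Fq Fqd := mk fun n => if n = 0 then a else 0

/-- The element `Π`. -/
def varPi : MaxOrd Fq Fqd := mk fun n => if n = 1 then 1 else 0

/-- The embedding `R = 𝔽_q⟦π⟧ → 𝒟`, `∑ rₙ πⁿ ↦ ∑ rₙ Πⁿᵈ`. -/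
noncomputable def ofBase [Finite Fqd] : Fq⟦X⟧ →+* MaxOrd Fq Fqd where
  toFun r := mk fun n => if Module.finrank Fq Fqd ∣ n then
    algebraMap Fq Fqd (PowerSeries.coeff (n / Module.finrank Fq Fqd) r) else 0
  map_zero' := by ext n; simp
  map_add' r s := by
    ext n
    by_cases h : Module.finrank Fq Fqd ∣ n <;> simp [h]
  map_one' := by
    have hd : 0 < Module.finrank Fq Fqd := Module.finrank_pos
    ext n
    rcases Nat.eq_zero_or_pos n with rfl | hn
    · simp [coeff_one]
    · by_cases h : Module.finrank Fq Fqd ∣ n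
      · have h0 : n / Module.finrank Fq Fqd ≠ 0 :=
          (Nat.div_pos (Nat.le_of_dvd hn h) hd).ne'
        simp only [coeff_mk, coeff_one, h, PowerSeries.coeff_one, hn.ne', h0, if_true, if_false, map_zero]
      · simp [coeff_one, h, hn.ne']
  map_mul' r s := by
    have hd : 0 < Module.finrank Fq Fqd := Module.finrank_pos
    generalize Module.finrank Fq Fqd = d at hd
    ext n
    rw [coeff_mul, coeff_mk]
    split_ifs with h
    · obtain ⟨m, rfl⟩ := h
      rw [Nat.mul_div_cancel_left _ hd, PowerSeries.coeff_mul, map_sum]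
      symm
      rw [← Finset.sum_filter_of_ne (p := fun p => d ∣ p.1 ∧ d ∣ p.2)]
      · symm
        refine Finset.sum_bij (fun p _ => (d * p.1, d * p.2)) ?_ ?_ ?_ ?_
        · rintro ⟨i, j⟩ hij
          simp only [Finset.HasAntidiagonal.mem_antidiagonal] at hij
          simp [← hij, mul_add]
        · rintro ⟨i, j⟩ _ ⟨i', j'⟩ _ hh
          simp [hd.ne'] at hh
          simp [hh]
        · rintro ⟨i, j⟩ hij
          simp only [Finset.mem_filter, Finset.HasAntidiagonal.mem_antidiagonal] at hij
          obtain ⟨hs, ⟨a, rfl⟩, ⟨b, rfl⟩⟩ := hij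
          refine ⟨(a, b), ?_, rfl⟩
          rw [← mul_add] at hs
          simpa using Nat.eq_of_mul_eq_mul_left hd hs
        · rintro ⟨i, j⟩ _
          simp [Nat.mul_div_cancel_left _ hd, AlgHom.commutes]
      · rintro ⟨i, j⟩ _ hne
        by_contra hcon
        apply hne
        rw [not_and_or] at hcon
        rcases hcon with hc | hc <;> simp [hc]
    · symm
      refine Finset.sum_eq_zero ?_
      rintro ⟨i, j⟩ hij
      simp only [Finset.HasAntidiagonal.mem_antidiagonal] at hij
      by_cases hi : d ∣ i
      · have hj : ¬ d ∣ j := fun hj => h (hij ▸ dvd_add hi hj)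
        simp [hj]
      · simp [hi]

theorem ofBase_commutes [Finite Fqd] (r : Fq⟦X⟧) (x : MaxOrd Fq Fqd) :
    ofBase r * x = x * ofBase r := by
  ext n
  rw [coeff_mul, coeff_mul, ← Finset.Nat.sum_antidiagonal_swap]
  refine Finset.sum_congr rfl ?_
  rintro ⟨i, j⟩ _
  simp only [Prod.fst_swap, Prod.snd_swap]
  simp only [ofBase, RingHom.coe_mk, MonoidHom.coe_mk, OneHom.coe_mk, coeff_mk]
  split_ifs with h
  · have : FiniteField.frobeniusAlgHom Fq Fqd ^ j = 1 := by
      rw [← orderOf_dvd_iff_pow_eq_one, FiniteField.orderOf_frobeniusAlgHom]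
      exact h
    rw [this, AlgHom.commutes, AlgHom.one_apply, mul_comm]
  · simp

noncomputable instance [Finite Fqd] : Algebra Fq⟦X⟧ (MaxOrd Fq Fqd) := RingHom.toAlgebra' ofBase ofBase_commutes

end MaxOrd

/-! ## Dieudonné modules -/

section Frobenius

variable (Fq k : Type*) [Field Fq] [Fintype Fq] [Field k] [Algebra Fq k]

/-- The Frobenius `∑ aₙ πⁿ ↦ ∑ aₙ ^ q πⁿ` of `k⟦π⟧`. -/
noncomputable def frob : k⟦X⟧ →+* k⟦X⟧ :=
  PowerSeries.map (FiniteField.frobeniusAlgHom Fq k : k →+* k)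

theorem frob_algebraMap (r : Fq⟦X⟧) :
    frob Fq k (algebraMap Fq⟦X⟧ k⟦X⟧ r) = algebraMap Fq⟦X⟧ k⟦X⟧ r := by
  ext n
  simp [frob, PowerSeries.algebraMap_apply'']

theorem frob_injective : Function.Injective (frob Fq k) :=
  PowerSeries.map_injective _ (RingHom.injective _)

instance [IsAlgClosure Fq k] : RingHomSurjective (frob Fq k) where
  is_surjective := by
    have : IsAlgClosed k := IsAlgClosure.isAlgClosed Fq
    refine PowerSeries.map_surjective _ fun x => ?_
    obtain ⟨y, hy⟩ := IsAlgClosed.exists_pow_nat_eq x (Fintype.card_pos (α := Fq))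
    exact ⟨y, hy⟩

/-- The Frobenius of the fraction field `L = k((π))` of `k⟦π⟧`. -/
noncomputable def frobFrac (L : Type*) [Field L] [Algebra k⟦X⟧ L] [IsFractionRing k⟦X⟧ L] :
    L →+* L :=
  IsFractionRing.map (A := k⟦X⟧) (B := k⟦X⟧) (frob_injective Fq k)

end Frobenius

section Modules

variable {Fq k : Type*} [Field Fq] [Fintype Fq] [Field k] [Algebra Fq k] [IsAlgClosure Fq k]
variable {M : Type*} [AddCommGroup M] [Module k⟦X⟧ M] [Module k M] [IsScalarTower k k⟦X⟧ M]

/-- `(M, φ)` is a Dieudonné `R`-module over `k`, where `R = 𝔽_q⟦π⟧`. -/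
structure IsDieudonneModule (φ : M →ₛₗ[frob Fq k] M) : Prop where
  free : Module.Free k⟦X⟧ M
  finite : Module.Finite k⟦X⟧ M
  injective : Function.Injective φ
  finite_coker : Module.Finite k (M ⧸ LinearMap.range φ)

/-- `(M, φ)` is connected: `φᵐ(M) ⊆ π M` for all large enough `m`. -/
def IsConnectedDieudonne (φ : M →ₛₗ[frob Fq k] M) : Prop :=
  ∃ m₀ : ℕ, ∀ m ≥ m₀, ∀ x : M, ∃ y : M, φ^[m] x = (PowerSeries.X : k⟦X⟧) • y

variable {Fqd : Type*} [Field Fqd] [Finite Fqd] [Algebra Fq Fqd] [Algebra Fqd k]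
  [Module (MaxOrd Fq Fqd)ᵐᵒᵖ M]

variable (Fqd) in
/-- The Dieudonné `R`-module `(M, φ)`, with the given right action of `𝒟` on `M`, is a Dieudonné
`𝒟`-module.  That the action of `𝒟` is `k⟦π⟧`-linear and extends the action of `R` is
expressed by `SMulCommClass` and `IsScalarTower` instances. -/
structure IsDieudonneDModule [Module Fq⟦X⟧ M] [IsScalarTower Fq⟦X⟧ k⟦X⟧ M]
    [IsScalarTower Fq⟦X⟧ (MaxOrd Fq Fqd)ᵐᵒᵖ M] [SMulCommClass (MaxOrd Fq Fqd)ᵐᵒᵖ k⟦X⟧ M]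
    (φ : M →ₛₗ[frob Fq k] M) : Prop extends IsDieudonneModule φ where
  rank_eq : Module.finrank k⟦X⟧ M = Module.finrank Fq Fqd ^ 2
  connected : IsConnectedDieudonne φ
  map_act : ∀ (δ : MaxOrd Fq Fqd) (x : M), φ (op δ • x) = op δ • φ x

variable (Fqd) in
/-- `(M, φ)` is exceptional: `Im φ = Im Π`. -/
def IsExceptional (φ : M →ₛₗ[frob Fq k] M) : Prop :=
  Set.range φ = Set.range fun x : M => op (MaxOrd.varPi : MaxOrd Fq Fqd) • x

variable (Fq Fqd k M) in
/-- The graded piece `M_i = {x | x λ = λ ^ (q ^ i) x for all λ ∈ 𝔽_{q^d}}`, where on the left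
`λ` acts through `𝔽_{q^d} ⊆ 𝒟` and on the right through the embedding `𝔽_{q^d} → k`.
It depends on `i` modulo `d` only. -/
def gradedPiece [SMulCommClass (MaxOrd Fq Fqd)ᵐᵒᵖ k⟦X⟧ M] (i : ℕ) : Submodule k⟦X⟧ M where
  carrier := {x | ∀ c : Fqd, op (MaxOrd.const c : MaxOrd Fq Fqd) • x =
    (PowerSeries.C (algebraMap Fqd k c ^ Fintype.card Fq ^ i) : k⟦X⟧) • x}
  zero_mem' c := by simp
  add_mem' hx hy c := by rw [smul_add, smul_add, hx c, hy c]
  smul_mem' r x hx c := by rw [smul_comm _ r, hx c, smul_comm]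

variable (Fqd) in
/-- `f_i`, the dimension over `k` of the cokernel of `φ_i : M_i → M_{i+1}`, the restriction
of `φ`. -/
noncomputable def dieudonneType [SMulCommClass (MaxOrd Fq Fqd)ᵐᵒᵖ k⟦X⟧ M]
    (φ : M →ₛₗ[frob Fq k] M) (i : ℕ) : ℕ :=
  Module.finrank k (gradedPiece Fq k M Fqd (i + 1) ⧸
    ((gradedPiece Fq k M Fqd i).map φ).submoduleOf (gradedPiece Fq k M Fqd (i + 1)))

variable (Fqd) in
/-- `End_𝒟(M, φ)`: the `k⟦π⟧`-linear endomorphisms of `M` that commute with `φ` and with `𝒟`;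
the product is composition. -/
def dieudonneEnd [Module Fq⟦X⟧ M] [IsScalarTower Fq⟦X⟧ k⟦X⟧ M]
    [SMulCommClass (MaxOrd Fq Fqd)ᵐᵒᵖ k⟦X⟧ M] (φ : M →ₛₗ[frob Fq k] M) :
    Subalgebra Fq⟦X⟧ (Module.End k⟦X⟧ M) where
  carrier := {g | (∀ x, g (φ x) = φ (g x)) ∧
    ∀ (δ : MaxOrd Fq Fqd) (x : M), g (op δ • x) = op δ • g x}
  mul_mem' {g h} hg hh :=
    ⟨fun x => by rw [Module.End.mul_apply, hh.1, hg.1, Module.End.mul_apply],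
      fun δ x => by rw [Module.End.mul_apply, hh.2, hg.2, Module.End.mul_apply]⟩
  add_mem' {g h} hg hh :=
    ⟨fun x => by rw [LinearMap.add_apply, hg.1, hh.1, ← map_add, LinearMap.add_apply],
      fun δ x => by rw [LinearMap.add_apply, hg.2, hh.2, ← smul_add, LinearMap.add_apply]⟩
  algebraMap_mem' r := by
    refine ⟨fun x => ?_, fun δ x => ?_⟩
    · rw [Module.algebraMap_end_apply, Module.algebraMap_end_apply, ← algebraMap_smul k⟦X⟧ r (φ x),
        ← algebraMap_smul k⟦X⟧ r x, map_smulₛₗ, frob_algebraMap]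
    · rw [Module.algebraMap_end_apply, Module.algebraMap_end_apply, ← algebraMap_smul k⟦X⟧ r x,
        ← algebraMap_smul k⟦X⟧ r (op δ • x), smul_comm (op δ)]

/-! ### The associated Dieudonné `D`-module -/

variable (L : Type*) [Field L] [Algebra k⟦X⟧ L] [IsFractionRing k⟦X⟧ L]

theorem frobFrac_algebraMap (r : k⟦X⟧) :
    frobFrac Fq k L (algebraMap k⟦X⟧ L r) = algebraMap k⟦X⟧ L (frob Fq k r) := by
  simp [frobFrac, IsFractionRing.map]

/-- The Frobenius-linear map `c ⊗ x ↦ Fr(c) ⊗ φ(x)` on `N = L ⊗ M`.  As `L` is the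
localization `K ⊗ k⟦π⟧`, where `K` is the fraction field of `R`, this `N` is `K ⊗ M`. -/
noncomputable def phiFrac (φ : M →ₛₗ[frob Fq k] M) :
    L ⊗[k⟦X⟧] M →ₛₗ[frob Fq k] L ⊗[k⟦X⟧] M :=
  TensorProduct.map
    { toFun := frobFrac Fq k L
      map_add' := map_add _
      map_smul' := fun r c => by
        rw [Algebra.smul_def, map_mul, frobFrac_algebraMap, Algebra.smul_def] } φ

@[simp] theorem phiFrac_tmul (φ : M →ₛₗ[frob Fq k] M) (c : L) (x : M) :
    phiFrac L φ (c ⊗ₜ x) = frobFrac Fq k L c ⊗ₜ φ x := rfl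

theorem phiFrac_smul (φ : M →ₛₗ[frob Fq k] M) (c : L) (x : L ⊗[k⟦X⟧] M) :
    phiFrac L φ (c • x) = frobFrac Fq k L c • phiFrac L φ x := by
  induction x with
  | zero => simp
  | tmul a m => simp [TensorProduct.smul_tmul']
  | add x y hx hy => rw [smul_add, map_add, hx, hy, map_add, smul_add]

variable (K : Type*) [Field K] [Algebra Fq⟦X⟧ K] [IsFractionRing Fq⟦X⟧ K]
  [Algebra Fq⟦X⟧ L] [IsScalarTower Fq⟦X⟧ k⟦X⟧ L] [Algebra K L] [IsScalarTower Fq⟦X⟧ K L]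

instance : SMulCommClass k⟦X⟧ K L := ⟨fun a b c => by
  simp only [Algebra.smul_def]; ring⟩

instance : SMulCommClass k⟦X⟧ Fq⟦X⟧ L := ⟨fun a b c => by
  simp only [Algebra.smul_def]; ring⟩

variable (Fq k) in
theorem frobFrac_base (a : K) : frobFrac Fq k L (algebraMap K L a) = algebraMap K L a := by
  have h : ∀ r : Fq⟦X⟧, frobFrac Fq k L (algebraMap K L (algebraMap Fq⟦X⟧ K r)) =
      algebraMap K L (algebraMap Fq⟦X⟧ K r) := fun r => by
    rw [← IsScalarTower.algebraMap_apply, IsScalarTower.algebraMap_apply Fq⟦X⟧ k⟦X⟧ L,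
      frobFrac_algebraMap, frob_algebraMap]
  obtain ⟨r, s, _, rfl⟩ := IsFractionRing.div_surjective (A := Fq⟦X⟧) a
  rw [map_div₀, map_div₀, h, h]

variable [Module Fq⟦X⟧ M] [IsScalarTower Fq⟦X⟧ k⟦X⟧ M]
  [IsScalarTower Fq⟦X⟧ (MaxOrd Fq Fqd)ᵐᵒᵖ M] [SMulCommClass (MaxOrd Fq Fqd)ᵐᵒᵖ k⟦X⟧ M]

variable (M Fqd) in
/-- The right action of `𝒟` on `N = L ⊗ M`, `(c ⊗ x) δ = c ⊗ x δ`. -/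
noncomputable def actOrd : (MaxOrd Fq Fqd)ᵐᵒᵖ →ₐ[Fq⟦X⟧] Module.End L (L ⊗[k⟦X⟧] M) :=
  ((Module.End.baseChangeHom k⟦X⟧ L M).restrictScalars Fq⟦X⟧).comp
    (Algebra.lsmul Fq⟦X⟧ k⟦X⟧ M)

variable (M Fqd) in
/-- The right action of the division algebra `D = K ⊗ 𝒟` on `N = L ⊗ M`, as a homomorphism on the
opposite algebra `Dᵒᵖ = K ⊗ 𝒟ᵒᵖ`. -/
noncomputable def actDiv :
    K ⊗[Fq⟦X⟧] (MaxOrd Fq Fqd)ᵐᵒᵖ →ₐ[K] Module.End L (L ⊗[k⟦X⟧] M) :=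
  Algebra.TensorProduct.lift (Algebra.ofId K _) (actOrd M Fqd L)
    fun a _ => Algebra.commutes a _

theorem actDiv_tmul (a : K) (δ : (MaxOrd Fq Fqd)ᵐᵒᵖ) (c : L) (x : M) :
    actDiv M Fqd L K (a ⊗ₜ δ) (c ⊗ₜ[k⟦X⟧] x) = a • (c ⊗ₜ[k⟦X⟧] (δ • x)) := by
  simp [actDiv, actOrd, Algebra.ofId_apply]
  rfl

variable (Fqd) in
/-- `End_D(N, φ)` for `N = L ⊗ M`: the `L`-linear endomorphisms of `N` that commute with `φ` and
with `D`. -/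
noncomputable def dieudonneEndFrac (φ : M →ₛₗ[frob Fq k] M) :
    Subalgebra K (Module.End L (L ⊗[k⟦X⟧] M)) where
  carrier := {g | (∀ x, g (phiFrac L φ x) = phiFrac L φ (g x)) ∧
    ∀ (δ : K ⊗[Fq⟦X⟧] (MaxOrd Fq Fqd)ᵐᵒᵖ) (x : L ⊗[k⟦X⟧] M),
      g (actDiv M Fqd L K δ x) = actDiv M Fqd L K δ (g x)}
  mul_mem' {g h} hg hh :=
    ⟨fun x => by rw [Module.End.mul_apply, hh.1, hg.1, Module.End.mul_apply],
      fun δ x => by rw [Module.End.mul_apply, hh.2, hg.2, Module.End.mul_apply]⟩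
  add_mem' {g h} hg hh :=
    ⟨fun x => by rw [LinearMap.add_apply, hg.1, hh.1, ← map_add, LinearMap.add_apply],
      fun δ x => by rw [LinearMap.add_apply, hg.2, hh.2, ← map_add, LinearMap.add_apply]⟩
  algebraMap_mem' r := by
    refine ⟨fun x => ?_, fun δ x => ?_⟩
    · rw [Module.algebraMap_end_apply, Module.algebraMap_end_apply, ← algebraMap_smul L r x,
        ← algebraMap_smul L r (phiFrac L φ x), phiFrac_smul, frobFrac_base]
    · rw [← Module.End.mul_apply, Algebra.commutes, Module.End.mul_apply]

noncomputable instance (φ : M →ₛₗ[frob Fq k] M) : Ring (dieudonneEndFrac Fqd L K φ) :=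
  @Subalgebra.toRing K (Module.End L (L ⊗[k⟦X⟧] M)) _ _ _ (dieudonneEndFrac Fqd L K φ)

variable (Fqd) in
/-- The natural map `End_𝒟(M, φ) → End_D(N, φ)`, `g ↦ L ⊗ g`. -/
noncomputable def dieudonneEndBaseChange (φ : M →ₛₗ[frob Fq k] M) :
    dieudonneEnd Fqd φ →ₐ[Fq⟦X⟧] dieudonneEndFrac Fqd L K φ :=
  AlgHom.codRestrict
    (S := (dieudonneEndFrac Fqd L K φ).restrictScalars Fq⟦X⟧)
    (((Module.End.baseChangeHom k⟦X⟧ L M).restrictScalars Fq⟦X⟧).comp (dieudonneEnd Fqd φ).val)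
    (by
      rintro ⟨g, hg⟩
      refine ⟨fun x => ?_, fun δ x => ?_⟩
      · change LinearMap.baseChange L g (phiFrac L φ x) = phiFrac L φ (LinearMap.baseChange L g x)
        induction x with
        | zero => simp
        | tmul a m => simp [hg.1]
        | add x y hx hy => simp only [map_add, hx, hy]
      · change LinearMap.baseChange L g (actDiv M Fqd L K δ x) =
          actDiv M Fqd L K δ (LinearMap.baseChange L g x)
        induction δ with
        | zero => simp
        | add y z hy hz => simp only [map_add, LinearMap.add_apply, hy, hz]
        | tmul a δ =>
          induction x with
          | zero => simp
          | tmul c m =>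
            simp only [actDiv_tmul, LinearMap.baseChange_tmul]
            rw [← algebraMap_smul L a, ← algebraMap_smul L a, map_smul, LinearMap.baseChange_tmul]
            congr 2
            exact hg.2 δ.unop m
          | add x y hx hy => simp only [map_add, hx, hy])

end Modules

/-! ## The standard order is hereditary -/

section Hereditary

/-! Exceptionality says that φ = Πψ with ψ a Frobenius-semilinear bijection of M, and this ψ
preserves every M_i. By Lang's argument over k (`span_fixed_eq_top`), lifted along powers of π
(`span_fixed_eq_top_of_bijective`), M is spanned over k⟦π⟧ by ψ-fixed vectors; projecting them to
the graded pieces shows the same for every M_i. As Im φ = Im Π, the cokernel of φ_i is M_{i+1}/ΠM_i.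
Lifting a basis of each cokernel to fixed vectors gives homogeneous e_a such that the Π^t e_a with t
< d form a basis of M (`exists_adaptedBasis`). Comparing ranks, d · ∑ f_i = d².

An endomorphism g commutes with the injective map Π, so it is determined by its restriction to M_d =
M_0. There the vectors Π^{d-1-i} e_a, for a in block i, form a basis of fixed vectors, so the matrix
of g is invariant under Frobenius, that is, has entries in R. A matrix over R arises in this way
exactly when it preserves the chain of submodules Π^{d-1-i} M_{i+1} of M_d, and this is the
divisibility by π of the blocks above the diagonal (`exists_matrix_of_end`, `exists_end_of_matrix`).
Coordinates are written along rows, so composition becomes the opposite multiplication; transposing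
and reversing the blocks turns the opposite into a standard order again.

The standard order is hereditary because a left ideal can be split column by column, and a nonzero
left ideal living in one column is isomorphic to a column of the order, a direct summand
(`projective_of_single_column`). Finally, a power of π carries any endomorphism of N into the image
of End_𝒟(M, φ), so End_D(N, φ) is K ⊗ End_𝒟(M, φ); the matrix algebra over K is the same base change
of the standard order. -/

theorem Module.Projective.of_ker_of_range {A N P : Type*} [Ring A] [AddCommGroup N] [Module A N]
    [AddCommGroup P] [Module A P] (g : N →ₗ[A] P) [Module.Projective A (LinearMap.ker g)]
    [Module.Projective A (LinearMap.range g)] : Module.Projective A N := by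
  obtain ⟨s, hs⟩ := Module.projective_lifting_property g.rangeRestrict LinearMap.id
    (LinearMap.surjective_rangeRestrict g)
  have hs' : ∀ y, g (s y) = y := fun y => by
    have := congrArg Subtype.val (LinearMap.congr_fun hs y)
    simpa using this
  let i : N →ₗ[A] LinearMap.ker g × LinearMap.range g :=
    LinearMap.prod ((LinearMap.id - s.comp g.rangeRestrict).codRestrict (LinearMap.ker g)
      fun x => by simp [hs']) g.rangeRestrict
  let r : LinearMap.ker g × LinearMap.range g →ₗ[A] N :=
    LinearMap.coprod (LinearMap.ker g).subtype s
  refine Module.Projective.of_split i r ?_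
  ext x
  simp [i, r]

variable {R : Type*} [CommRing R] {ϖ : R} {d : ℕ} {f : Fin d → ℕ}

theorem mem_stdHereditaryOrder
    {m : Matrix (Σ i : Fin d, Fin (f i)) (Σ i : Fin d, Fin (f i)) R} :
    m ∈ stdHereditaryOrder ϖ f ↔ ∀ a b, a.1 < b.1 → ϖ ∣ m a b := by
  simp only [← Ideal.mem_span_singleton]
  rfl

theorem single_mem_stdHereditaryOrder {a b : Σ i : Fin d, Fin (f i)} {r : R}
    (h : a.1 < b.1 → ϖ ∣ r) : Matrix.single a b r ∈ stdHereditaryOrder ϖ f := by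
  rw [mem_stdHereditaryOrder]
  intro a' b' hab
  by_cases h' : a = a' ∧ b = b'
  · obtain ⟨rfl, rfl⟩ := h'
    simpa using h hab
  · rw [Matrix.single_apply, if_neg h']
    exact dvd_zero _

variable (ϖ) in
/-- The diagonal idempotent at `c`. -/
def stdIdem (c : Σ i : Fin d, Fin (f i)) : stdHereditaryOrder ϖ f :=
  ⟨Matrix.single c c 1, single_mem_stdHereditaryOrder fun h => absurd h (lt_irrefl _)⟩

theorem coe_mul_stdIdem_apply (x : stdHereditaryOrder ϖ f) (a b c : Σ i : Fin d, Fin (f i)) :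
    (x * stdIdem ϖ c).1 a b = if b = c then x.1 a b else 0 := by
  change (x.1 * Matrix.single c c 1 : Matrix _ _ R) a b = _
  split_ifs with h
  · subst h; simp
  · rw [Matrix.mul_single_apply_of_ne _ _ _ _ _ h]

theorem coe_stdIdem_mul_apply (x : stdHereditaryOrder ϖ f) (a b c : Σ i : Fin d, Fin (f i)) :
    (stdIdem ϖ c * x).1 a b = if a = c then x.1 a b else 0 := by
  change (Matrix.single c c 1 * x.1 : Matrix _ _ R) a b = _
  split_ifs with h
  · subst h; simp
  · rw [Matrix.single_mul_apply_of_ne _ _ _ _ _ h]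

/-! ### Left ideals of the standard order over a discrete valuation ring. -/

section DVR

variable [IsDomain R] [IsDiscreteValuationRing R]

/-- A nonzero left ideal supported in the column `b` contains an entry dividing all others. -/
theorem exists_dvd_entries (hϖ : Irreducible ϖ) (b : Σ i : Fin d, Fin (f i))
    {J : Ideal (stdHereditaryOrder ϖ f)} (hJ : ∃ x ∈ J, ∃ c, x.1 c b ≠ 0) :
    ∃ x ∈ J, ∃ c, x.1 c b ≠ 0 ∧ ∀ z ∈ J, ∀ a, x.1 c b ∣ z.1 a b ∧
      (a.1 < c.1 → ϖ * x.1 c b ∣ z.1 a b) := by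
  let v : R → ℕ := fun r => (IsDiscreteValuationRing.addVal R r).toNat
  have hv : ∀ r, r ≠ 0 → (v r : ℕ∞) = IsDiscreteValuationRing.addVal R r := fun r hr =>
    ENat.natCast_toNat (by rwa [Ne, IsDiscreteValuationRing.addVal_eq_top_iff])
  -- Valuation and block index are minimised lexicographically: since the block index is less than
  -- `d`, the pair is encoded as valuation times `d` plus index. An entry in a strictly smaller
  -- block must then have strictly larger valuation, whence the extra factor `ϖ`.
  have hex : ∃ n : ℕ, ∃ x ∈ J, ∃ c, x.1 c b ≠ 0 ∧ v (x.1 c b) * d + c.1 = n := by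
    obtain ⟨x, hx, c, hc⟩ := hJ
    exact ⟨_, x, hx, c, hc, rfl⟩
  classical
  obtain ⟨x, hx, c, hc, hn⟩ := Nat.find_spec hex
  refine ⟨x, hx, c, hc, fun z hz a => ?_⟩
  by_cases hza : z.1 a b = 0
  · simp [hza]
  have hmin := Nat.find_min' hex ⟨z, hz, a, hza, rfl⟩
  rw [← hn] at hmin
  have h1 : v (x.1 c b) ≤ v (z.1 a b) := by
    by_contra! hlt
    have := Nat.mul_le_mul_right d (Nat.succ_le_of_lt hlt)
    rw [Nat.succ_mul] at this
    have := a.1.2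
    omega
  refine ⟨?_, fun hac => ?_⟩
  · rw [← IsDiscreteValuationRing.addVal_le_iff_dvd, ← hv _ hc, ← hv _ hza]
    exact_mod_cast h1
  · have h2 : 1 + v (x.1 c b) ≤ v (z.1 a b) := by
      by_contra! hlt
      have h3 : v (x.1 c b) = v (z.1 a b) := by omega
      rw [h3] at hmin
      have : a.1.1 < c.1.1 := hac
      omega
    rw [← IsDiscreteValuationRing.addVal_le_iff_dvd, IsDiscreteValuationRing.addVal_mul,
      IsDiscreteValuationRing.addVal_uniformizer hϖ, ← hv _ hc, ← hv _ hza]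
    exact_mod_cast h2

/-- With a minimal entry x_cb, the element y = E_cc x generates J, and h ↦ h y is an isomorphism
from the column ideal Λ E_cc onto J. The inverse divides the entries of column b by x_cb; the extra
factor `ϖ` in the rows of smaller blocks is exactly what puts the quotient in the order. -/
theorem projective_of_single_column (hϖ : Irreducible ϖ) (b : Σ i : Fin d, Fin (f i))
    (J : Ideal (stdHereditaryOrder ϖ f)) (hJ : ∀ x ∈ J, x * stdIdem ϖ b = x) :
    Module.Projective (stdHereditaryOrder ϖ f) J := by
  have hcol : ∀ x ∈ J, ∀ a b', b' ≠ b → x.1 a b' = 0 := fun x hx a b' hb' => by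
    rw [← hJ x hx, coe_mul_stdIdem_apply, if_neg hb']
  by_cases hne : ∃ x ∈ J, ∃ c, x.1 c b ≠ 0
  swap
  · push Not at hne
    have : J = ⊥ := by
      rw [eq_bot_iff]
      intro x hx
      rw [Submodule.mem_bot]
      ext a b'
      by_cases h : b' = b
      · subst h; exact hne x hx a
      · exact hcol x hx a b' h
    subst this
    infer_instance
  obtain ⟨x, hx, c, hc, hmin⟩ := exists_dvd_entries hϖ b hne
  let y : stdHereditaryOrder ϖ f := stdIdem ϖ c * x
  have hy : y ∈ J := J.mul_mem_left _ hx
  have hmul : ∀ (h : stdHereditaryOrder ϖ f) a, (h * y).1 a b = h.1 a c * x.1 c b := by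
    intro h a
    change ((h.1 * y.1) : Matrix _ _ R) a b = _
    rw [Matrix.mul_apply, Finset.sum_eq_single c]
    · simp [y, coe_stdIdem_mul_apply]
    · intro a' _ ha'
      simp only [y, coe_stdIdem_mul_apply, if_neg ha', mul_zero]
    · simp
  have hex : ∀ z : J, ∃ h : stdHereditaryOrder ϖ f, h * stdIdem ϖ c = h ∧ h * y = z := by
    rintro ⟨z, hz⟩
    choose q hq using fun a => (hmin z hz a).1
    refine ⟨⟨Matrix.of fun a b' => if b' = c then q a else 0, ?_⟩, ?_, ?_⟩
    · rw [mem_stdHereditaryOrder]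
      intro a b' hab
      rw [Matrix.of_apply]
      split_ifs with h
      · subst h
        have := (hmin z hz a).2 hab
        rw [hq a, mul_comm] at this
        exact (mul_dvd_mul_iff_left hc).mp this
      · exact dvd_zero _
    · ext a b'
      rw [coe_mul_stdIdem_apply]
      simp +contextual
    · ext a b'
      by_cases h : b' = b
      · subst h
        rw [hmul]
        simp [hq a, mul_comm]
      · rw [hcol z hz a b' h, hcol _ (J.mul_mem_left _ hy) a b' h]
  have huniq : ∀ h h' : stdHereditaryOrder ϖ f, h * stdIdem ϖ c = h → h' * stdIdem ϖ c = h' →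
      h * y = h' * y → h = h' := by
    intro h h' h1 h2 h3
    rw [← h1, ← h2]
    ext a b'
    rw [coe_mul_stdIdem_apply, coe_mul_stdIdem_apply]
    split_ifs with hb
    · subst hb
      have := hmul h a
      rw [h3, hmul] at this
      exact mul_right_cancel₀ hc this.symm
    · rfl
  choose i hi1 hi2 using hex
  refine Module.Projective.of_split (M := stdHereditaryOrder ϖ f)
    { toFun := i
      map_add' := fun z w => huniq _ _ (hi1 _) (by rw [add_mul, hi1, hi1])
        (by rw [add_mul, hi2, hi2, hi2]; rfl)
      map_smul' := fun r z => huniq _ _ (hi1 _)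
        (by rw [RingHom.id_apply, smul_eq_mul, mul_assoc, hi1])
        (by rw [RingHom.id_apply, smul_eq_mul, mul_assoc, hi2, hi2]; rfl) }
    ((LinearMap.toSpanSingleton _ _ y).codRestrict J fun h => J.mul_mem_left _ hy) ?_
  ext z : 2
  exact hi2 z

/-- Induction on the set of columns that may be nonzero. Right multiplication by the idempotent at b
is linear for the left action; its image lies in the single column b and its kernel has column b
removed. -/
theorem projective_leftIdeal (hϖ : Irreducible ϖ) (J : Ideal (stdHereditaryOrder ϖ f)) :
    Module.Projective (stdHereditaryOrder ϖ f) J := by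
  classical
  suffices H : ∀ (s : Finset (Σ i : Fin d, Fin (f i))) (J : Ideal (stdHereditaryOrder ϖ f)),
      (∀ x ∈ J, ∀ b ∉ s, x * stdIdem ϖ b = 0) → Module.Projective (stdHereditaryOrder ϖ f) J from
    H Finset.univ J fun x _ b hb => absurd (Finset.mem_univ b) hb
  intro s
  induction s using Finset.induction_on with
  | empty =>
    intro J hJ
    have : J = ⊥ := by
      rw [eq_bot_iff]
      intro x hx
      rw [Submodule.mem_bot]
      ext a b
      have := congrArg (fun m => m.1 a b) (hJ x hx b (by simp))
      simpa [coe_mul_stdIdem_apply] using this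
    subst this
    infer_instance
  | insert b s hb ih =>
    intro J hJ
    let g : J →ₗ[stdHereditaryOrder ϖ f] stdHereditaryOrder ϖ f :=
      (LinearMap.toSpanSingleton _ _ (stdIdem ϖ b)).comp J.subtype
    have hidem : stdIdem ϖ b * stdIdem ϖ b = stdIdem ϖ b := by
      ext a b'
      rw [coe_mul_stdIdem_apply]
      split_ifs with h
      · rfl
      · change 0 = Matrix.single b b (1 : R) a b'
        rw [Matrix.single_apply, if_neg fun h' => h h'.2.symm]
    have h1 : Module.Projective (stdHereditaryOrder ϖ f) (LinearMap.range g) := by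
      apply projective_of_single_column hϖ b
      rintro _ ⟨x, rfl⟩
      change x.1 * stdIdem ϖ b * stdIdem ϖ b = x.1 * stdIdem ϖ b
      rw [mul_assoc, hidem]
    have h2 : Module.Projective (stdHereditaryOrder ϖ f) (LinearMap.ker g) := by
      have := ih ((LinearMap.ker g).map J.subtype) (by
        rintro _ ⟨x, hx, rfl⟩ c hc
        by_cases h : c = b
        · subst h; exact hx
        · exact hJ _ x.2 c (by simp [h, hc]))
      exact Module.Projective.of_equiv'
        (Submodule.equivMapOfInjective J.subtype J.injective_subtype (LinearMap.ker g)).symm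
    exact Module.Projective.of_ker_of_range (A := stdHereditaryOrder ϖ f) (N := J) g

end DVR

variable (ϖ f) in
/-- Transposition and reversal of the blocks identify the opposite of a standard order with a
standard order. -/
def stdHereditaryOrderOp :
    (stdHereditaryOrder ϖ f)ᵐᵒᵖ ≃ₐ[R] stdHereditaryOrder ϖ (f ∘ Fin.rev) :=
  let ρ : (Σ i : Fin d, Fin ((f ∘ Fin.rev) i)) ≃ Σ i : Fin d, Fin (f i) :=
    Equiv.sigmaCongrLeft (β := fun i => Fin (f i)) Fin.revPerm
  have hρ : ∀ a, (ρ a).1 = Fin.rev a.1 := fun _ => rfl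
  have hρ' : ∀ a, (ρ.symm a).1 = Fin.rev a.1 := fun a => by
    rw [eq_comm, Fin.rev_eq_iff, ← hρ, Equiv.apply_symm_apply]
  { toFun := fun m => ⟨Matrix.reindex ρ.symm ρ.symm m.unop.1.transpose, by
      rw [mem_stdHereditaryOrder]
      intro a b hab
      refine mem_stdHereditaryOrder.mp m.unop.2 _ _ ?_
      change (ρ b).1 < (ρ a).1
      rw [hρ, hρ, Fin.rev_lt_rev]
      exact hab⟩
    invFun := fun m => op ⟨Matrix.reindex ρ ρ m.1.transpose, by
      rw [mem_stdHereditaryOrder]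
      intro a b hab
      refine mem_stdHereditaryOrder.mp m.2 _ _ ?_
      rw [hρ', hρ', Fin.rev_lt_rev]
      exact hab⟩
    left_inv := fun m => by
      apply unop_injective
      ext a b
      simp
    right_inv := fun m => by
      ext a b
      simp
    map_mul' := fun m n => by
      ext1
      simp [Matrix.submatrix_mul_equiv]
    map_add' := fun m n => by
      ext a b
      simp
    commutes' := fun r => by
      ext a b
      simp [Matrix.algebraMap_eq_diagonal, Matrix.diagonal_apply] }

theorem projective_ideals_of_ringEquiv {A B : Type*} [Ring A] [Ring B] (e : A ≃+* B)
    (h : ∀ I : Ideal A, Module.Projective A I) (I : Ideal B) : Module.Projective B I := by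
  have := h (I.comap (e : A →+* B))
  let _ := RingHomInvPair.of_ringEquiv e
  let _ := RingHomInvPair.symm (e : A →+* B) (e.symm : B →+* A)
  exact Module.Projective.of_equiv (R := A) (S := B) (M := I.comap (e : A →+* B)) (N := I)
    (σ := (e : A →+* B)) (σ' := (e.symm : B →+* A))
    { toFun := fun x => ⟨e x.1, x.2⟩
      invFun := fun x => ⟨e.symm x.1, by
        change e (e.symm x.1) ∈ I
        rw [e.apply_symm_apply]
        exact x.2⟩
      left_inv := fun x => by simp
      right_inv := fun x => by simp
      map_add' := fun x y => by ext; simp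
      map_smul' := fun r x => by ext; simp }

theorem IsHereditaryRing.of_ringEquiv {A B : Type*} [Ring A] [Ring B] (e : A ≃+* B)
    (h : IsHereditaryRing A) : IsHereditaryRing B :=
  ⟨projective_ideals_of_ringEquiv e h.1, projective_ideals_of_ringEquiv (RingEquiv.op e) h.2⟩

/-- Right ideals are left ideals of the opposite ring, which is again a standard order, with the
blocks reversed. -/
theorem isHereditaryRing_stdHereditaryOrder [IsDomain R] [IsDiscreteValuationRing R]
    (hϖ : Irreducible ϖ) : IsHereditaryRing (stdHereditaryOrder ϖ f) :=
  ⟨projective_leftIdeal hϖ, projective_ideals_of_ringEquiv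
    (stdHereditaryOrderOp ϖ f).symm.toRingEquiv (projective_leftIdeal hϖ)⟩

end Hereditary

/-! ## Frobenius-semilinear maps over an algebraically closed field -/

section Lang

open Polynomial in
/-- The coordinates of a fixed vector, as polynomials in the last one. -/
noncomputable def fixedCoord {k : Type*} [Field k] (q : ℕ) (a : ℕ → k) : ℕ → k[X]
  | 0 => C (a 0) * X ^ q
  | i + 1 => fixedCoord q a i ^ q + C (a (i + 1)) * X ^ q

open Polynomial in
theorem X_pow_dvd_fixedCoord {k : Type*} [Field k] {q : ℕ} (hq : 1 < q) (a : ℕ → k) (n : ℕ) :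
    X ^ q ∣ fixedCoord q a n := by
  induction n with
  | zero => exact dvd_mul_left _ _
  | succ n ih => exact dvd_add (ih.trans (dvd_pow_self _ (by omega))) (dvd_mul_left _ _)

-- No cancellation is possible in the recursion: a nonzero coordinate is divisible by X^q, so its
-- q-th power has degree at least q² > q, whereas the added term has degree at most q.
open Polynomial in
theorem fixedCoord_ne_zero {k : Type*} [Field k] {q : ℕ} (hq : 1 < q) (a : ℕ → k) (n : ℕ)
    (h : ∃ i ≤ n, a i ≠ 0) : fixedCoord q a n ≠ 0 := by
  induction n with
  | zero =>
    obtain ⟨i, hi, hai⟩ := h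
    obtain rfl : i = 0 := by omega
    simpa [fixedCoord] using hai
  | succ n ih =>
    rw [fixedCoord]
    by_cases hn : ∃ i ≤ n, a i ≠ 0
    · have h0 := ih hn
      have h1 : q ≤ (fixedCoord q a n).natDegree := by
        simpa using natDegree_le_of_dvd (X_pow_dvd_fixedCoord hq a n) h0
      intro h2
      have h3 : fixedCoord q a n ^ q = - (C (a (n + 1)) * X ^ q) := eq_neg_of_add_eq_zero_left h2
      have h4 := congrArg natDegree h3
      rw [natDegree_pow, natDegree_neg] at h4
      have h5 : (C (a (n + 1)) * X ^ q).natDegree ≤ q := natDegree_C_mul_X_pow_le _ _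
      nlinarith
    · push Not at hn
      obtain ⟨i, hi, hai⟩ := h
      have hin : i = n + 1 := by
        by_contra hne
        exact hai (hn i (by omega))
      subst hin
      have h0 : ∀ m ≤ n, fixedCoord q a m = 0 := by
        intro m hm
        induction m with
        | zero => simp [fixedCoord, hn 0 (by omega)]
        | succ m ihm =>
          rw [fixedCoord, ihm (by omega), hn (m + 1) hm]
          simp [show q ≠ 0 by omega]
      rw [h0 n le_rfl]
      simpa [show q ≠ 0 by omega] using hai

-- Writing the coordinate as X^q Q, a nonzero solution of X^q Q = X is a root of X^{q-1} Q - 1, a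
-- nonconstant polynomial.
open Polynomial in
theorem exists_eval_fixedCoord_eq {k : Type*} [Field k] [IsAlgClosed k] {q : ℕ} (hq : 1 < q)
    (a : ℕ → k) (n : ℕ) (h : ∃ i ≤ n, a i ≠ 0) :
    ∃ y : k, y ≠ 0 ∧ (fixedCoord q a n).eval y = y := by
  obtain ⟨Q, hQ⟩ := X_pow_dvd_fixedCoord hq a n
  have hQ0 : Q ≠ 0 := by
    rintro rfl
    exact fixedCoord_ne_zero hq a n h (by simpa using hQ)
  have hdeg : (X ^ (q - 1) * Q - 1 : k[X]).degree ≠ 0 := by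
    have h1 : (X ^ (q - 1) * Q - 1 : k[X]).natDegree = q - 1 + Q.natDegree := by
      rw [← C_1, natDegree_sub_C, natDegree_mul (pow_ne_zero _ X_ne_zero) hQ0, natDegree_X_pow]
    intro h2
    rw [degree_eq_natDegree (by rintro h3; simp [h3] at h2), h1] at h2
    norm_cast at h2
    omega
  obtain ⟨y, hy⟩ := IsAlgClosed.exists_root _ hdeg
  have hy' : y ^ (q - 1) * Q.eval y = 1 := by
    simpa [IsRoot, sub_eq_zero] using hy
  refine ⟨y, ?_, ?_⟩
  · rintro rfl
    simp [show q - 1 ≠ 0 by omega] at hy'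
  · have hyq : y ^ q = y * y ^ (q - 1) := by
      rw [← pow_succ']
      congr 1
      omega
    rw [hQ, eval_mul, eval_pow, eval_X, hyq, mul_assoc, hy', mul_one]

variable {k : Type*} [Field k] [IsAlgClosed k] {σ : k →+* k} {q : ℕ}
variable {V : Type*} [AddCommGroup V] [Module k V]

/-- Take the iterates u_i = ψ^i(v) up to the first linear relation u_{m+1} = ∑ a_i u_i. Then ∑ x_i
u_i is fixed if x_0 = a_0 x_m^q and x_{i+1} = x_i^q + a_{i+1} x_m^q. Eliminating all unknowns but y
= x_m leaves one polynomial equation, with `fixedCoord` giving the x_i. -/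
theorem exists_fixed_ne_zero [Module.Finite k V] [Nontrivial V] (hq : 1 < q)
    (hσ : ∀ c, σ c = c ^ q) (ψ : V →ₛₗ[σ] V) (hψ : Function.Injective ψ) :
    ∃ v : V, v ≠ 0 ∧ ψ v = v := by
  obtain ⟨v, hv⟩ := exists_ne (0 : V)
  let u : ℕ → V := fun i => ψ^[i] v
  have hu : ∀ i, ψ (u i) = u (i + 1) := fun i => (Function.iterate_succ_apply' ψ i v).symm
  have hu0 : ∀ i, u i ≠ 0 := by
    intro i
    induction i with
    | zero => exact hv
    | succ i ih =>
      rw [← hu]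
      exact fun h => ih (hψ (by rw [h, map_zero]))
  have hex : ∃ n, u n ∈ Submodule.span k (u '' Set.Iio n) := by
    obtain ⟨n, hn⟩ := monotone_stabilizes_iff_noetherian.mpr
      (inferInstance : IsNoetherian k V)
      ⟨fun n => Submodule.span k (u '' Set.Iio n), fun m n h =>
        Submodule.span_mono (Set.image_mono (Set.Iio_subset_Iio h))⟩
    refine ⟨n, ?_⟩
    have h1 := hn (n + 1) (Nat.le_succ n)
    change Submodule.span k (u '' Set.Iio n) = Submodule.span k (u '' Set.Iio (n + 1)) at h1
    rw [h1]
    exact Submodule.subset_span ⟨n, by simp, rfl⟩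
  classical
  -- Minimality ensures that u_m is not a combination of earlier iterates, so the fixed vector built
  -- below, whose last coordinate is y ≠ 0, is nonzero.
  obtain ⟨n, hn, hmin⟩ : ∃ n, u n ∈ Submodule.span k (u '' Set.Iio n) ∧
      ∀ m < n, u m ∉ Submodule.span k (u '' Set.Iio m) :=
    ⟨Nat.find hex, Nat.find_spec hex, fun m hm => Nat.find_min hex hm⟩
  obtain rfl | ⟨m, rfl⟩ : n = 0 ∨ ∃ m, n = m + 1 := by cases n <;> simp
  · simp at hn
    exact absurd hn (hu0 0)
  obtain ⟨a, ha⟩ : ∃ a : ℕ → k, u (m + 1) = ∑ i ∈ Finset.range (m + 1), a i • u i := by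
    rw [show Set.Iio (m + 1) = ((Finset.range (m + 1) : Finset ℕ) : Set ℕ) by ext; simp,
      Submodule.mem_span_image_finset_iff_exists_fun'] at hn
    obtain ⟨a, ha⟩ := hn
    exact ⟨a, ha.symm⟩
  have hane : ∃ i ≤ m, a i ≠ 0 := by
    by_contra! hcon
    apply hu0 (m + 1)
    rw [ha]
    refine Finset.sum_eq_zero fun i hi => ?_
    rw [hcon i (by simpa [Nat.lt_succ_iff] using hi), zero_smul]
  obtain ⟨y, hy0, hy⟩ := exists_eval_fixedCoord_eq hq a m hane
  let x : ℕ → k := fun i => (fixedCoord q a i).eval y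
  have hx0 : x 0 = a 0 * y ^ q := by simp [x, fixedCoord]
  have hxs : ∀ i, x (i + 1) = x i ^ q + a (i + 1) * y ^ q := by simp [x, fixedCoord]
  have hxm : x m = y := hy
  refine ⟨∑ i ∈ Finset.range (m + 1), x i • u i, ?_, ?_⟩
  · intro h
    apply hmin m (Nat.lt_succ_self m)
    rw [Finset.sum_range_succ, hxm] at h
    have h2 : u m = (-y⁻¹) • ∑ i ∈ Finset.range m, x i • u i := by
      rw [eq_neg_of_add_eq_zero_left h, smul_neg, neg_smul, neg_neg, smul_smul,
        inv_mul_cancel₀ hy0, one_smul]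
    rw [h2]
    refine Submodule.smul_mem _ _ (Submodule.sum_mem _ fun i hi => Submodule.smul_mem _ _
      (Submodule.subset_span ⟨i, by simpa using hi, rfl⟩))
  · have h1 : ψ (∑ i ∈ Finset.range (m + 1), x i • u i) =
        ∑ i ∈ Finset.range m, x i ^ q • u (i + 1) + y ^ q • u (m + 1) := by
      rw [map_sum, Finset.sum_range_succ]
      simp only [map_smulₛₗ, hσ, hu, hxm]
    rw [h1, ha, Finset.smul_sum, Finset.sum_range_succ', Finset.sum_range_succ', ← add_assoc,
      ← Finset.sum_add_distrib, hx0, smul_smul, mul_comm]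
    congr 1
    refine Finset.sum_congr rfl fun i _ => ?_
    rw [hxs, add_smul, smul_smul, mul_comm (y ^ q)]

theorem exists_pow_sub_eq (hq : 1 < q) (c : k) : ∃ b : k, b ^ q - b = c := by
  open Polynomial in
  obtain ⟨b, hb⟩ := IsAlgClosed.exists_root (X ^ q - X - C c : k[X]) (by
    have h : (X ^ q - X - C c : k[X]).natDegree = q := by
      rw [natDegree_sub_C, FiniteField.X_pow_card_sub_X_natDegree_eq _ hq]
    intro h2
    rw [degree_eq_natDegree (by rintro h3; simp [h3] at h2), h] at h2
    norm_cast at h2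
    omega)
  exact ⟨b, by simpa [Polynomial.IsRoot, sub_eq_zero] using hb⟩

/-- On the span of the fixed vectors, `ψ - 1` is surjective. -/
theorem exists_map_sub_eq_of_mem_span (hq : 1 < q) (hσ : ∀ c, σ c = c ^ q) (ψ : V →ₛₗ[σ] V)
    {w : V} (hw : w ∈ Submodule.span k {v | ψ v = v}) :
    ∃ z ∈ Submodule.span k {v | ψ v = v}, ψ z - z = w := by
  induction hw using Submodule.closure_induction with
  | zero => exact ⟨0, zero_mem _, by simp⟩
  | add x y _ _ hx hy =>
    obtain ⟨x', hx', rfl⟩ := hx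
    obtain ⟨y', hy', rfl⟩ := hy
    exact ⟨x' + y', add_mem hx' hy', by rw [map_add]; abel⟩
  | smul_mem c x hx =>
    obtain ⟨b, hb⟩ := exists_pow_sub_eq hq c
    refine ⟨b • x, Submodule.smul_mem _ _ (Submodule.subset_span hx), ?_⟩
    rw [map_smulₛₗ, hσ, show ψ x = x from hx, ← sub_smul, hb]

/-- A Frobenius-semilinear injective endomorphism of a finite-dimensional space over an
algebraically closed field has a spanning set of fixed vectors. -/
theorem span_fixed_eq_top [Module.Finite k V] (hq : 1 < q) (hσ : ∀ c, σ c = c ^ q)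
    (ψ : V →ₛₗ[σ] V) (hψ : Function.Injective ψ) : Submodule.span k {v | ψ v = v} = ⊤ := by
  set W := Submodule.span k {v | ψ v = v} with hW
  by_contra hne
  have hle : W ≤ W.comap ψ := by
    rw [hW, Submodule.span_le]
    intro v hv
    rw [SetLike.mem_coe, Submodule.mem_comap, show ψ v = v from hv]
    exact Submodule.subset_span hv
  have hsurj : ∀ w ∈ W, ∃ z ∈ W, ψ z = w := by
    intro w hw
    induction hw using Submodule.closure_induction with
    | zero => exact ⟨0, zero_mem _, by simp⟩
    | add x y _ _ hx hy =>
      obtain ⟨x', hx', rfl⟩ := hx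
      obtain ⟨y', hy', rfl⟩ := hy
      exact ⟨x' + y', add_mem hx' hy', map_add _ _ _⟩
    | smul_mem c x hx =>
      obtain ⟨b, hb⟩ := IsAlgClosed.exists_pow_nat_eq c (show 0 < q by omega)
      exact ⟨b • x, Submodule.smul_mem _ _ (Submodule.subset_span hx),
        by rw [map_smulₛₗ, hσ, show ψ x = x from hx, hb]⟩
  -- Since ψ maps W onto W and is injective on V, ψ v ∈ W forces v ∈ W. If V/W were nonzero, it
  -- would contain a nonzero fixed class.
  have hinj : Function.Injective (W.mapQ W ψ hle) := by
    rw [injective_iff_map_eq_zero]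
    intro v
    induction v using Submodule.Quotient.induction_on with
    | H v =>
    intro h
    rw [Submodule.mapQ_apply, Submodule.Quotient.mk_eq_zero] at h
    obtain ⟨z, hz, hzv⟩ := hsurj _ h
    rw [Submodule.Quotient.mk_eq_zero, ← hψ hzv]
    exact hz
  have : Nontrivial (V ⧸ W) := Submodule.Quotient.nontrivial_iff.mpr hne
  obtain ⟨v, hv0, hv⟩ := exists_fixed_ne_zero hq hσ (W.mapQ W ψ hle) hinj
  induction v using Submodule.Quotient.induction_on with
  | H v =>
  rw [Submodule.mapQ_apply, Submodule.Quotient.eq] at hv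
  -- The class of v is fixed, so ψ v - v lies in W and equals ψ z - z with z ∈ W. Then v - z is a
  -- genuine fixed vector, which puts v in W.
  obtain ⟨z, hz, hzv⟩ := exists_map_sub_eq_of_mem_span hq hσ ψ hv
  apply hv0
  rw [Submodule.Quotient.mk_eq_zero, ← sub_add_cancel v z]
  refine add_mem (Submodule.subset_span ?_) hz
  rw [Set.mem_ofPred_eq, map_sub, sub_eq_sub_iff_sub_eq_sub, ← hzv]

end Lang

/-! ## Frobenius-semilinear maps over `k⟦X⟧` -/

section Complete

variable {k : Type*} [Field k]
variable {M : Type*} [AddCommGroup M] [Module k⟦X⟧ M]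

variable (k M) in
theorem exists_X_smul_submodule : ∃ N : Submodule k⟦X⟧ M,
    ∀ x, x ∈ N ↔ ∃ y, x = (PowerSeries.X : k⟦X⟧) • y :=
  ⟨LinearMap.range (LinearMap.lsmul k⟦X⟧ M PowerSeries.X), fun x => by
    simp [eq_comm]⟩

section Free

variable [Module.Free k⟦X⟧ M] [Module.Finite k⟦X⟧ M]

theorem eq_zero_of_forall_X_pow_smul {x : M}
    (h : ∀ n : ℕ, ∃ y : M, x = (PowerSeries.X ^ n : k⟦X⟧) • y) : x = 0 := by
  let b := Module.Free.chooseBasis k⟦X⟧ M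
  apply b.repr.injective
  ext i n
  obtain ⟨y, rfl⟩ := h (n + 1)
  simp [PowerSeries.coeff_X_pow_mul']

theorem exists_sum_X_pow_smul (x : ℕ → M) : ∃ s : M, ∀ N : ℕ, ∃ y : M,
    s = ∑ n ∈ Finset.range N, (PowerSeries.X ^ n : k⟦X⟧) • x n + (PowerSeries.X ^ N : k⟦X⟧) • y := by
  let b := Module.Free.chooseBasis k⟦X⟧ M
  have key : ∀ u : ℕ → k⟦X⟧, ∃ s : k⟦X⟧, ∀ N, PowerSeries.X ^ N ∣
      s - ∑ n ∈ Finset.range N, PowerSeries.X ^ n * u n := by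
    intro u
    -- Terms with index above m do not affect the m-th coefficient, so it is read off the partial
    -- sum of the first m + 1 terms.
    refine ⟨PowerSeries.mk fun m => PowerSeries.coeff m
      (∑ n ∈ Finset.range (m + 1), PowerSeries.X ^ n * u n), fun N => ?_⟩
    rw [PowerSeries.X_pow_dvd_iff]
    intro m hm
    rw [map_sub, PowerSeries.coeff_mk, sub_eq_zero,
      ← Finset.sum_range_add_sum_Ico _ (Nat.succ_le_of_lt hm), map_add, left_eq_add, map_sum]
    refine Finset.sum_eq_zero fun n hn => ?_
    rw [PowerSeries.coeff_X_pow_mul', if_neg]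
    simp at hn
    omega
  choose s hs using fun i => key fun n => b.repr (x n) i
  choose y hy using hs
  refine ⟨∑ i, s i • b i, fun N => ⟨∑ i, y i N • b i, ?_⟩⟩
  apply b.repr.injective
  ext i : 1
  have := hy i N
  rw [sub_eq_iff_eq_add] at this
  simp [Finsupp.single_apply, this, add_comm, Finsupp.finsetSum_apply]

/-- Nakayama's lemma for `k⟦X⟧`. -/
theorem eq_top_of_sup_X_smul {W : Submodule k⟦X⟧ M}
    (h : ∀ x : M, ∃ w ∈ W, ∃ y : M, x = w + (PowerSeries.X : k⟦X⟧) • y) : W = ⊤ := by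
  rw [eq_top_iff]
  refine Submodule.le_of_le_smul_of_le_jacobson_bot (I := Ideal.span {(PowerSeries.X : k⟦X⟧)})
    Module.Finite.fg_top ?_ ?_
  · rw [IsLocalRing.jacobson_eq_maximalIdeal _ bot_ne_top, PowerSeries.maximalIdeal_eq_span_X]
  · intro x _
    obtain ⟨w, hw, y, rfl⟩ := h x
    exact Submodule.add_mem_sup hw (Submodule.smul_mem_smul (Ideal.mem_span_singleton_self _)
      Submodule.mem_top)

end Free

variable [Module k M] [IsScalarTower k k⟦X⟧ M]

theorem C_smul_eq_smul (c : k) (x : M) : (PowerSeries.C c : k⟦X⟧) • x = c • x := by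
  rw [← algebraMap_smul k⟦X⟧ c x]
  rfl

theorem smul_eq_constantCoeff_smul {x : M} (hx : (PowerSeries.X : k⟦X⟧) • x = 0) (r : k⟦X⟧) :
    r • x = PowerSeries.constantCoeff r • x := by
  conv_lhs => rw [PowerSeries.eq_shift_mul_X_add_const r]
  rw [add_smul, mul_smul, hx, smul_zero, zero_add, C_smul_eq_smul]

theorem finite_of_X_smul_eq_zero [Module.Finite k⟦X⟧ M]
    (h : ∀ x : M, (PowerSeries.X : k⟦X⟧) • x = 0) : Module.Finite k M := by
  obtain ⟨s, hs⟩ := Module.Finite.fg_top (R := k⟦X⟧) (M := M)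
  refine ⟨s, ?_⟩
  rw [eq_top_iff]
  intro x _
  have hx : x ∈ Submodule.span k⟦X⟧ (s : Set M) := hs ▸ Submodule.mem_top
  induction hx using Submodule.closure_induction with
  | zero => exact zero_mem _
  | add x y _ _ hx hy => exact add_mem (hx trivial) (hy trivial)
  | smul_mem c x hx =>
    rw [smul_eq_constantCoeff_smul (h x)]
    exact Submodule.smul_mem _ _ (Submodule.subset_span hx)

variable [Module.Free k⟦X⟧ M] [Module.Finite k⟦X⟧ M]
variable {Fq : Type*} [Field Fq] [Fintype Fq] [Algebra Fq k]

theorem frob_C (c : k) : frob Fq k (PowerSeries.C c) = PowerSeries.C (c ^ Fintype.card Fq) := by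
  simp [frob]

@[simp] theorem frob_X : frob Fq k PowerSeries.X = PowerSeries.X := by
  simp [frob]

variable [IsAlgClosed k] (ψ : M →ₛₗ[frob Fq k] M) (hψ : Function.Bijective ψ)
include hψ

/-- The map induced on M/πM is injective: if ψ x = π y and y = ψ z, then x = π z. So Lang's argument
applies to this finite-dimensional space. -/
theorem exists_quotient_fixed : ∀ N : Submodule k⟦X⟧ M,
    (∀ x, x ∈ N ↔ ∃ y, x = (PowerSeries.X : k⟦X⟧) • y) →
    Submodule.span k {v : M ⧸ N | ∃ x, v = N.mkQ x ∧ ψ x - x ∈ N} = ⊤ := by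
  intro N hN
  have hle : N ≤ N.comap ψ := by
    intro x hx
    obtain ⟨y, rfl⟩ := (hN x).mp hx
    exact (hN _).mpr ⟨ψ y, by rw [map_smulₛₗ, frob_X]⟩
  let σ : k →+* k := FiniteField.frobeniusAlgHom Fq k
  let ψ' : M ⧸ N →ₛₗ[σ] M ⧸ N :=
    { toFun := N.mapQ N ψ hle
      map_add' := map_add _
      map_smul' := fun c x => by
        rw [← C_smul_eq_smul, map_smulₛₗ, frob_C, C_smul_eq_smul]
        rfl }
  have hinj : Function.Injective ψ' := by
    rw [injective_iff_map_eq_zero]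
    intro v
    induction v using Submodule.Quotient.induction_on with
    | H v =>
    intro h
    change N.mapQ N ψ hle _ = 0 at h
    rw [Submodule.mapQ_apply, Submodule.Quotient.mk_eq_zero, hN] at h
    obtain ⟨y, hy⟩ := h
    obtain ⟨z, rfl⟩ := hψ.2 y
    rw [Submodule.Quotient.mk_eq_zero, hN]
    exact ⟨z, hψ.1 (by rw [hy, map_smulₛₗ, frob_X])⟩
  have : Module.Finite k (M ⧸ N) := finite_of_X_smul_eq_zero fun x => by
    induction x using Submodule.Quotient.induction_on with
    | H x =>
    rw [← Submodule.Quotient.mk_smul, Submodule.Quotient.mk_eq_zero, hN]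
    exact ⟨x, rfl⟩
  rw [eq_top_iff, ← span_fixed_eq_top (σ := σ) Fintype.one_lt_card (fun c => rfl) ψ' hinj]
  refine Submodule.span_mono fun v hv => ?_
  induction v using Submodule.Quotient.induction_on with
  | H v =>
  refine ⟨v, rfl, ?_⟩
  rw [← Submodule.Quotient.eq]
  exact hv

/-- The equation is solvable modulo π, by Artin–Schreier equations on the spanning fixed classes.
Completeness of M then gives an exact solution by successive approximation. -/
theorem exists_map_sub_eq (y : M) : ∃ x : M, ψ x - x = y := by
  obtain ⟨N, hN⟩ := exists_X_smul_submodule k M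
  have hspan := exists_quotient_fixed ψ hψ N hN
  have step : ∀ y : M, ∃ x z : M, y = ψ x - x + (PowerSeries.X : k⟦X⟧) • z := by
    intro y
    have hy : N.mkQ y ∈ Submodule.span k {v : M ⧸ N | ∃ x, v = N.mkQ x ∧ ψ x - x ∈ N} :=
      hspan ▸ Submodule.mem_top
    have : ∃ x, N.mkQ y = N.mkQ (ψ x - x) := by
      generalize N.mkQ y = v at hy
      induction hy using Submodule.closure_induction with
      | zero => exact ⟨0, by simp⟩
      | add x y _ _ hx hy =>
        obtain ⟨x', hx', rfl⟩ := hx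
        obtain ⟨y', hy', rfl⟩ := hy
        exact ⟨x' + y', by simp only [map_add, map_sub]; abel⟩
      | smul_mem c x hx =>
        obtain ⟨x, rfl, hx⟩ := hx
        obtain ⟨b, hb⟩ := exists_pow_sub_eq (Fintype.one_lt_card (α := Fq)) c
        refine ⟨(PowerSeries.C b : k⟦X⟧) • x, ?_⟩
        rw [← C_smul_eq_smul, ← map_smul, Submodule.mkQ_apply, Submodule.mkQ_apply,
          Submodule.Quotient.eq]
        have : (PowerSeries.C c : k⟦X⟧) • x - (ψ ((PowerSeries.C b : k⟦X⟧) • x) -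
            (PowerSeries.C b : k⟦X⟧) • x) =
            - ((PowerSeries.C (b ^ Fintype.card Fq) : k⟦X⟧) • (ψ x - x)) := by
          rw [map_smulₛₗ, frob_C, ← hb, map_sub]
          simp only [sub_smul, smul_sub]
          abel
        rw [this]
        exact neg_mem (N.smul_mem _ hx)
    obtain ⟨x, hx⟩ := this
    rw [Submodule.mkQ_apply, Submodule.mkQ_apply, Submodule.Quotient.eq, hN] at hx
    obtain ⟨z, hz⟩ := hx
    exact ⟨x, z, by rw [← hz]; abel⟩
  choose x z hxz using step
  -- Here w n is the remainder after n corrections: w n = (ψ - 1)(x (w n)) + π w (n + 1). The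
  -- solution is the convergent sum of the π^n x (w n), its error being divisible by every power of
  -- π.
  let w : ℕ → M := fun n => z^[n] y
  have hw : ∀ n, w n = ψ (x (w n)) - x (w n) + (PowerSeries.X : k⟦X⟧) • w (n + 1) := fun n => by
    simp only [w, Function.iterate_succ_apply']
    exact hxz _
  have hsum : ∀ N, y = ψ (∑ n ∈ Finset.range N, (PowerSeries.X ^ n : k⟦X⟧) • x (w n)) -
      ∑ n ∈ Finset.range N, (PowerSeries.X ^ n : k⟦X⟧) • x (w n) +
        (PowerSeries.X ^ N : k⟦X⟧) • w N := by
    intro N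
    induction N with
    | zero => simp [w]
    | succ N ih =>
      conv_lhs => rw [ih, hw N]
      rw [Finset.sum_range_succ, map_add, map_smulₛₗ, map_pow, frob_X, pow_succ]
      simp only [smul_sub, smul_add, mul_smul]
      abel
  obtain ⟨s, hs⟩ := exists_sum_X_pow_smul (k := k) fun n => x (w n)
  refine ⟨s, ?_⟩
  rw [← sub_eq_zero]
  refine eq_zero_of_forall_X_pow_smul (k := k) fun N => ?_
  obtain ⟨t, ht⟩ := hs N
  refine ⟨ψ t - t - w N, ?_⟩
  conv_lhs => rw [hsum N, ht, map_add, map_smulₛₗ, map_pow, frob_X]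
  simp only [smul_sub]
  abel

/-- A class fixed modulo π lifts to a fixed vector: if ψ v - v = π z and z = ψ u - u, then v - π u
is fixed and congruent to v. Nakayama's lemma finishes the argument. -/
theorem span_fixed_eq_top_of_bijective : Submodule.span k⟦X⟧ {x | ψ x = x} = ⊤ := by
  obtain ⟨N, hN⟩ := exists_X_smul_submodule k M
  have hspan := exists_quotient_fixed ψ hψ N hN
  refine eq_top_of_sup_X_smul fun x => ?_
  have hx : N.mkQ x ∈ Submodule.span k {v : M ⧸ N | ∃ x, v = N.mkQ x ∧ ψ x - x ∈ N} :=
    hspan ▸ Submodule.mem_top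
  have hle : Submodule.span k {v : M ⧸ N | ∃ x, v = N.mkQ x ∧ ψ x - x ∈ N} ≤
      ((Submodule.span k⟦X⟧ {x | ψ x = x}).map N.mkQ).restrictScalars k := by
    rw [Submodule.span_le]
    rintro _ ⟨v, rfl, hv⟩
    obtain ⟨z, hz⟩ := (hN _).mp hv
    obtain ⟨u, rfl⟩ := exists_map_sub_eq ψ hψ z
    refine ⟨v - (PowerSeries.X : k⟦X⟧) • u, Submodule.subset_span ?_, ?_⟩
    · rw [Set.mem_ofPred_eq, map_sub, map_smulₛₗ, frob_X, sub_eq_sub_iff_sub_eq_sub, hz, smul_sub]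
    · rw [map_sub, sub_eq_self, Submodule.mkQ_apply, Submodule.Quotient.mk_eq_zero, hN]
      exact ⟨u, rfl⟩
  obtain ⟨w, hw, hwx⟩ := hle hx
  rw [Submodule.mkQ_apply, Submodule.mkQ_apply, eq_comm, Submodule.Quotient.eq, hN] at hwx
  obtain ⟨y, hy⟩ := hwx
  exact ⟨w, hw, y, by rw [← hy]; abel⟩

end Complete

/-! ## The maximal order and its action -/

namespace MaxOrd

variable {Fq Fqd : Type*} [Field Fq] [Fintype Fq] [Field Fqd] [Algebra Fq Fqd]

@[simp] theorem coeff_const (a : Fqd) (n : ℕ) :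
    (const a : MaxOrd Fq Fqd).coeff n = if n = 0 then a else 0 := rfl

@[simp] theorem coeff_varPi (n : ℕ) :
    (varPi : MaxOrd Fq Fqd).coeff n = if n = 1 then 1 else 0 := rfl

theorem coeff_const_mul (a : Fqd) (b : MaxOrd Fq Fqd) (n : ℕ) :
    (const a * b).coeff n = a * b.coeff n := by
  rw [coeff_mul, Finset.sum_eq_single (0, n)]
  · simp
  · rintro ⟨i, j⟩ h hne
    have : i ≠ 0 := by
      rintro rfl
      simp_all
    simp [this]
  · simp

theorem coeff_mul_varPi_zero (a : MaxOrd Fq Fqd) : (a * varPi).coeff 0 = 0 := by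
  simp [coeff_mul]

theorem coeff_mul_varPi_succ (a : MaxOrd Fq Fqd) (n : ℕ) :
    (a * varPi).coeff (n + 1) = a.coeff n := by
  rw [coeff_mul, Finset.sum_eq_single (n, 1)]
  · simp
  · rintro ⟨i, j⟩ h hne
    have : j ≠ 1 := by
      rintro rfl
      simp_all
    simp [this]
  · simp

theorem coeff_varPi_mul_const (a : Fqd) (n : ℕ) :
    (varPi * const a : MaxOrd Fq Fqd).coeff n = if n = 1 then a ^ Fintype.card Fq else 0 := by
  rw [coeff_mul]
  split_ifs with hn
  · subst hn
    rw [Finset.sum_eq_single (1, 0)]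
    · simp
    · rintro ⟨i, j⟩ h hne
      have : i ≠ 1 := by
        rintro rfl
        simp_all
      simp [this]
    · simp
  · refine Finset.sum_eq_zero ?_
    rintro ⟨i, j⟩ h
    simp only [Finset.HasAntidiagonal.mem_antidiagonal] at h
    by_cases hi : i = 1
    · have : j ≠ 0 := by omega
      simp [this]
    · simp [hi]

theorem varPi_mul_const (a : Fqd) :
    (varPi * const a : MaxOrd Fq Fqd) = const (a ^ Fintype.card Fq) * varPi := by
  ext n
  rw [coeff_varPi_mul_const, coeff_const_mul]
  simp

variable (Fq Fqd) in
/-- The embedding of the constants into the maximal order. -/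
def constHom : Fqd →+* MaxOrd Fq Fqd where
  toFun := const
  map_zero' := by ext; simp
  map_one' := by ext; simp [coeff_one]
  map_add' a b := by ext n; by_cases hn : n = 0 <;> simp [hn]
  map_mul' a b := by ext n; simp [coeff_const_mul]

theorem coeff_varPi_pow (m n : ℕ) :
    ((varPi : MaxOrd Fq Fqd) ^ m).coeff n = if n = m then 1 else 0 := by
  induction m generalizing n with
  | zero => simp [coeff_one]
  | succ m ih =>
    rw [pow_succ]
    cases n with
    | zero => simp [coeff_mul_varPi_zero]
    | succ n => simp [coeff_mul_varPi_succ, ih]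

theorem eq_const_add_mul_varPi (a : MaxOrd Fq Fqd) :
    ∃ b : MaxOrd Fq Fqd, a = const (a.coeff 0) + b * varPi := by
  refine ⟨mk fun n => a.coeff (n + 1), ?_⟩
  ext n
  cases n with
  | zero => simp [coeff_mul_varPi_zero]
  | succ n => simp [coeff_mul_varPi_succ]

variable [Finite Fqd]

theorem ofBase_X : (ofBase PowerSeries.X : MaxOrd Fq Fqd) = varPi ^ Module.finrank Fq Fqd := by
  have hd : 0 < Module.finrank Fq Fqd := Module.finrank_pos
  ext n
  rw [coeff_varPi_pow]
  simp only [ofBase, RingHom.coe_mk, MonoidHom.coe_mk, OneHom.coe_mk, coeff_mk]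
  by_cases h : Module.finrank Fq Fqd ∣ n
  · obtain ⟨m, rfl⟩ := h
    by_cases hm : m = 1
    · subst hm
      simp [Nat.div_self hd]
    · simp [Nat.mul_div_cancel_left _ hd, PowerSeries.coeff_X, hm, hd.ne']
  · have : n ≠ Module.finrank Fq Fqd := by
      rintro rfl
      exact h dvd_rfl
    simp [h, this]

theorem ofBase_C (c : Fq) :
    (ofBase (PowerSeries.C c) : MaxOrd Fq Fqd) = const (algebraMap Fq Fqd c) := by
  have hd : 0 < Module.finrank Fq Fqd := Module.finrank_pos
  ext n
  simp only [ofBase, RingHom.coe_mk, MonoidHom.coe_mk, OneHom.coe_mk, coeff_mk, coeff_const]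
  by_cases h : Module.finrank Fq Fqd ∣ n
  · obtain ⟨m, rfl⟩ := h
    by_cases hm : m = 0
    · subst hm
      simp
    · simp [Nat.mul_div_cancel_left _ hd, PowerSeries.coeff_C, hm, hd.ne']
  · have : n ≠ 0 := by
      rintro rfl
      exact h (dvd_zero _)
    simp [h, this]

end MaxOrd

theorem frobeniusAlgHom_pow_apply {F E : Type*} [Field F] [Fintype F] [Field E] [Algebra F E]
    (n : ℕ) (c : E) : (FiniteField.frobeniusAlgHom F E ^ n) c = c ^ Fintype.card F ^ n := by
  simp_rw [AlgHom.coe_pow, FiniteField.coe_frobeniusAlgHom, pow_iterate]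

/-! ### The grading of M by the eigenspaces of the constants. -/

section Grading

variable {Fq k : Type*} [Field Fq] [Fintype Fq] [Field k] [Algebra Fq k]
variable {M : Type*} [AddCommGroup M] [Module k⟦X⟧ M] [Module k M] [IsScalarTower k k⟦X⟧ M]
variable {Fqd : Type*} [Field Fqd] [Finite Fqd] [Algebra Fq Fqd] [Algebra Fqd k]
  [Module (MaxOrd Fq Fqd)ᵐᵒᵖ M] [SMulCommClass (MaxOrd Fq Fqd)ᵐᵒᵖ k⟦X⟧ M]

variable (Fq k M Fqd) in
/-- The action of `Π` on `M`. -/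
noncomputable def piEnd : Module.End k⟦X⟧ M :=
  Module.toModuleEnd k⟦X⟧ M (op (MaxOrd.varPi : MaxOrd Fq Fqd))

theorem piEnd_apply (x : M) : piEnd Fq k M Fqd x = op (MaxOrd.varPi : MaxOrd Fq Fqd) • x := rfl

variable (Fq k M Fqd) in
/-- The action of the constants on `M`. -/
noncomputable def constEnd : Fqd →+* Module.End k⟦X⟧ M where
  toFun c := Module.toModuleEnd k⟦X⟧ M (op (MaxOrd.const c : MaxOrd Fq Fqd))
  map_zero' := by
    rw [show (MaxOrd.const 0 : MaxOrd Fq Fqd) = 0 from map_zero (MaxOrd.constHom Fq Fqd), op_zero,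
      map_zero]
  map_one' := by
    rw [show (MaxOrd.const 1 : MaxOrd Fq Fqd) = 1 from map_one (MaxOrd.constHom Fq Fqd), op_one,
      map_one]
  map_add' a b := by
    rw [show (MaxOrd.const (a + b) : MaxOrd Fq Fqd) = _ from map_add (MaxOrd.constHom Fq Fqd) a b,
      op_add, map_add]
    rfl
  map_mul' a b := by
    rw [mul_comm, show (MaxOrd.const (b * a) : MaxOrd Fq Fqd) = _ from
      map_mul (MaxOrd.constHom Fq Fqd) b a, op_mul, map_mul]
    rfl

theorem constEnd_apply (c : Fqd) (x : M) :
    constEnd Fq k M Fqd c x = op (MaxOrd.const c : MaxOrd Fq Fqd) • x := rfl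

theorem mem_gradedPiece {n : ℕ} {x : M} : x ∈ gradedPiece Fq k M Fqd n ↔
    ∀ c : Fqd, constEnd Fq k M Fqd c x = (algebraMap Fqd k c ^ Fintype.card Fq ^ n) • x := by
  simp only [← C_smul_eq_smul]
  rfl

theorem constEnd_piEnd (c : Fqd) (x : M) : constEnd Fq k M Fqd c (piEnd Fq k M Fqd x) =
    piEnd Fq k M Fqd (constEnd Fq k M Fqd (c ^ Fintype.card Fq) x) := by
  simp only [constEnd_apply, piEnd_apply, smul_smul, ← op_mul, MaxOrd.varPi_mul_const]

theorem piEnd_mem {n : ℕ} {x : M} (hx : x ∈ gradedPiece Fq k M Fqd n) :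
    piEnd Fq k M Fqd x ∈ gradedPiece Fq k M Fqd (n + 1) := by
  rw [mem_gradedPiece] at hx ⊢
  intro c
  rw [constEnd_piEnd, hx, ← C_smul_eq_smul, map_smul, C_smul_eq_smul, map_pow, ← pow_mul,
    ← pow_succ']

theorem piEnd_pow_mem {n : ℕ} {x : M} (hx : x ∈ gradedPiece Fq k M Fqd n) (t : ℕ) :
    (piEnd Fq k M Fqd ^ t) x ∈ gradedPiece Fq k M Fqd (n + t) := by
  induction t with
  | zero => exact hx
  | succ t ih =>
    rw [pow_succ', Module.End.mul_apply, ← add_assoc]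
    exact piEnd_mem ih

/-- The Frobenius of 𝔽_{q^d} over 𝔽_q has order d. -/
theorem gradedPiece_congr {m n : ℕ} (h : m ≡ n [MOD Module.finrank Fq Fqd]) :
    gradedPiece Fq k M Fqd m = gradedPiece Fq k M Fqd n := by
  ext x
  rw [mem_gradedPiece, mem_gradedPiece]
  refine forall_congr' fun c => ?_
  rw [← map_pow, ← map_pow, ← frobeniusAlgHom_pow_apply, ← frobeniusAlgHom_pow_apply,
    pow_eq_pow_of_modEq h (by
      rw [← FiniteField.orderOf_frobeniusAlgHom Fq Fqd, pow_orderOf_eq_one])]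

theorem mem_gradedPiece_of_piEnd_mem (hinj : Function.Injective (piEnd Fq k M Fqd)) {n : ℕ} {x : M}
    (hx : piEnd Fq k M Fqd x ∈ gradedPiece Fq k M Fqd (n + 1)) :
    x ∈ gradedPiece Fq k M Fqd n := by
  rw [mem_gradedPiece] at hx ⊢
  intro c
  obtain ⟨b, rfl⟩ : ∃ b : Fqd, b ^ Fintype.card Fq = c :=
    (Finite.injective_iff_surjective.mp
      (RingHom.injective (FiniteField.frobeniusAlgHom Fq Fqd : Fqd →+* Fqd))) c
  apply hinj
  rw [← constEnd_piEnd, hx, ← C_smul_eq_smul, ← C_smul_eq_smul, map_smul, map_pow (algebraMap Fqd k) b,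
    ← pow_mul, ← pow_succ']

section Phi

variable (φ : M →ₛₗ[frob Fq k] M)
  (hφ : ∀ (δ : MaxOrd Fq Fqd) (x : M), φ (op δ • x) = op δ • φ x)
include hφ

theorem map_mem_gradedPiece {n : ℕ} {x : M} (hx : x ∈ gradedPiece Fq k M Fqd n) :
    φ x ∈ gradedPiece Fq k M Fqd (n + 1) := by
  rw [mem_gradedPiece] at hx ⊢
  intro c
  rw [constEnd_apply, ← hφ, ← constEnd_apply (k := k), hx, ← C_smul_eq_smul, map_smulₛₗ, frob_C,
    C_smul_eq_smul, ← pow_mul, ← pow_succ]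

theorem mem_gradedPiece_of_map_mem (hinj : Function.Injective φ) {n : ℕ} {x : M}
    (hx : φ x ∈ gradedPiece Fq k M Fqd (n + 1)) : x ∈ gradedPiece Fq k M Fqd n := by
  rw [mem_gradedPiece] at hx ⊢
  intro c
  apply hinj
  rw [constEnd_apply, hφ, ← constEnd_apply (k := k), hx, ← C_smul_eq_smul, ← C_smul_eq_smul,
    map_smulₛₗ, frob_C, ← pow_mul, ← pow_succ]

end Phi

/-! ### The action of the base ring -/

variable [Module Fq⟦X⟧ M] [IsScalarTower Fq⟦X⟧ k⟦X⟧ M] [IsScalarTower Fq⟦X⟧ (MaxOrd Fq Fqd)ᵐᵒᵖ M]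

theorem ofBase_smul (r : Fq⟦X⟧) (x : M) : op (MaxOrd.ofBase r : MaxOrd Fq Fqd) • x =
    algebraMap Fq⟦X⟧ k⟦X⟧ r • x := by
  rw [algebraMap_smul, ← one_smul (MaxOrd Fq Fqd)ᵐᵒᵖ x, ← smul_assoc r, smul_smul, mul_one]
  congr 1
  rw [← op_one, ← op_smul, Algebra.smul_def, mul_one]
  rfl

theorem piEnd_pow_finrank (x : M) :
    (piEnd Fq k M Fqd ^ Module.finrank Fq Fqd) x = (PowerSeries.X : k⟦X⟧) • x := by
  have h := ofBase_smul (k := k) (Fqd := Fqd) (PowerSeries.X : Fq⟦X⟧) x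
  rw [PowerSeries.algebraMap_apply'', PowerSeries.map_X, MaxOrd.ofBase_X] at h
  rw [← h, piEnd, ← map_pow, ← op_pow]
  rfl

theorem constEnd_algebraMap (c : Fq) (x : M) :
    constEnd Fq k M Fqd (algebraMap Fq Fqd c) x = algebraMap Fq k c • x := by
  have h := ofBase_smul (k := k) (Fqd := Fqd) (PowerSeries.C c : Fq⟦X⟧) x
  rw [PowerSeries.algebraMap_apply'', PowerSeries.map_C, MaxOrd.ofBase_C] at h
  rw [← C_smul_eq_smul, ← h]
  rfl

variable [IsScalarTower Fq Fqd k]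

theorem aeval_end_apply {T : Module.End k⟦X⟧ M} {v : k} {x : M} (h : T x = v • x)
    (p : Polynomial k) : Polynomial.aeval T p x = p.eval v • x := by
  induction p using Polynomial.induction_on' with
  | add p q hp hq => simp [hp, hq, add_smul]
  | monomial n a =>
    rw [Polynomial.aeval_monomial, Polynomial.eval_monomial, Module.End.mul_apply,
      Module.algebraMap_end_apply, mul_smul]
    congr 1
    induction n with
    | zero => simp
    | succ n ih =>
      rw [pow_succ', Module.End.mul_apply, ih, ← C_smul_eq_smul, map_smul, h, C_smul_eq_smul,
        smul_smul, pow_succ]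

theorem aeval_constEnd (a : Fqd) (p : Polynomial Fq) :
    Polynomial.aeval (constEnd Fq k M Fqd a) (p.map (algebraMap Fq k)) =
      constEnd Fq k M Fqd (Polynomial.aeval a p) := by
  rw [Polynomial.aeval_def, Polynomial.eval₂_map, Polynomial.aeval_def, Polynomial.hom_eval₂]
  congr 1
  ext c x
  simp [constEnd_algebraMap]

/-- Every constant is a polynomial over 𝔽_q in the generator, and Frobenius fixes the coefficients,
so the eigenvalue condition need only be tested on the generator. -/
theorem mem_gradedPiece_of_gen (pb : PowerBasis Fq Fqd) {n : ℕ} {x : M}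
    (h : constEnd Fq k M Fqd pb.gen x = (algebraMap Fqd k pb.gen ^ Fintype.card Fq ^ n) • x) :
    x ∈ gradedPiece Fq k M Fqd n := by
  rw [mem_gradedPiece]
  intro c
  obtain ⟨p, rfl⟩ := pb.exists_eq_aeval' c
  rw [← aeval_constEnd, aeval_end_apply h]
  congr 1
  rw [← map_pow, ← map_pow, ← frobeniusAlgHom_pow_apply, ← frobeniusAlgHom_pow_apply,
    ← Polynomial.aeval_algHom_apply, ← Polynomial.aeval_algebraMap_apply, Polynomial.aeval_def,
    Polynomial.eval_map]

variable (Fq k M Fqd) in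
/-- `M` is the direct sum of its graded pieces. -/
theorem exists_gradedProj {d : ℕ} (hd : Module.finrank Fq Fqd = d) :
    ∃ p : Fin d → Module.End k⟦X⟧ M, (∀ x, ∑ i, p i x = x) ∧
      (∀ (i : Fin d) (x : M), p i x ∈ gradedPiece Fq k M Fqd (i + 1)) ∧
      ∀ i j : Fin d, ∀ x ∈ gradedPiece Fq k M Fqd (j + 1), p i x = if i = j then x else 0 := by
  subst hd
  have hd : 0 < Module.finrank Fq Fqd := Module.finrank_pos
  have : NeZero (Module.finrank Fq Fqd) := ⟨hd.ne'⟩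
  let pb := Field.powerBasisOfFiniteOfSeparable Fq Fqd
  -- These are the d distinct conjugates of the generator, so their nodal polynomial is its minimal
  -- polynomial and annihilates T. The Lagrange basis polynomials evaluated at T are the
  -- projections. The index i stands for degree i + 1, so the degrees run from 1 to d.
  let v : Fin (Module.finrank Fq Fqd) → k :=
    fun i => algebraMap Fqd k pb.gen ^ Fintype.card Fq ^ (i + 1 : ℕ)
  have hv : Function.Injective v := by
    intro i j hij
    simp only [v, pow_succ, pow_mul] at hij
    have h1 := RingHom.injective (FiniteField.frobeniusAlgHom Fq k : k →+* k) hij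
    rw [← map_pow, ← map_pow, ← frobeniusAlgHom_pow_apply, ← frobeniusAlgHom_pow_apply] at h1
    exact (FiniteField.bijective_frobeniusAlgHom_pow Fq Fqd).1
      (pb.algHom_ext (RingHom.injective _ h1))
  let T := constEnd Fq k M Fqd pb.gen
  have hnodal : Lagrange.nodal Finset.univ v = (minpoly Fq pb.gen).map (algebraMap Fq k) := by
    symm
    refine Polynomial.eq_of_monic_of_dvd_of_natDegree_le Lagrange.nodal_monic
      ((minpoly.monic pb.isIntegral_gen).map _) ?_ ?_
    · rw [Lagrange.nodal_eq]
      refine Finset.prod_dvd_of_coprime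
        (fun i _ j _ hij => Polynomial.isCoprime_X_sub_C_of_isUnit_sub
          (isUnit_iff_ne_zero.mpr (sub_ne_zero.mpr (hv.ne hij)))) fun i _ => ?_
      rw [Polynomial.dvd_iff_isRoot, Polynomial.IsRoot, Polynomial.eval_map]
      simp only [v]
      rw [← map_pow, ← frobeniusAlgHom_pow_apply, ← Polynomial.aeval_def,
        Polynomial.aeval_algebraMap_apply, Polynomial.aeval_algHom_apply, minpoly.aeval, map_zero,
        map_zero]
    · rw [(minpoly.monic pb.isIntegral_gen).natDegree_map, Lagrange.natDegree_nodal,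
        pb.natDegree_minpoly, ← pb.finrank]
      simp
  have hT : Polynomial.aeval T (Lagrange.nodal Finset.univ v) = 0 := by
    rw [hnodal, aeval_constEnd, minpoly.aeval, map_zero]
  refine ⟨fun i => Polynomial.aeval T (Lagrange.basis Finset.univ v i), fun x => ?_, fun i x => ?_,
    fun i j x hx => ?_⟩
  · rw [← LinearMap.sum_apply, ← map_sum, Lagrange.sum_basis hv.injOn Finset.univ_nonempty, map_one,
      Module.End.one_apply]
  · apply mem_gradedPiece_of_gen pb
    -- The product of X - v_i with the i-th Lagrange polynomial is a scalar multiple of the nodal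
    -- polynomial, so the image of the i-th projection consists of eigenvectors for v_i.
    have h1 : (Polynomial.X - Polynomial.C (v i)) * Lagrange.basis Finset.univ v i =
        Polynomial.C (Lagrange.nodalWeight Finset.univ v i) * Lagrange.nodal Finset.univ v := by
      rw [Lagrange.basis_eq_prod_sub_inv_mul_nodal_div (Finset.mem_univ i),
        ← Lagrange.nodal_erase_eq_nodal_div (Finset.mem_univ i),
        Lagrange.nodal_eq_mul_nodal_erase (Finset.mem_univ i)]
      ring
    have h2 := congrArg (fun p => Polynomial.aeval T p x) h1
    simp only [map_mul, hT, mul_zero, LinearMap.zero_apply, map_sub, Polynomial.aeval_X,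
      Polynomial.aeval_C, Module.End.mul_apply, LinearMap.sub_apply, Module.algebraMap_end_apply,
      sub_eq_zero] at h2
    exact h2
  · rw [aeval_end_apply (mem_gradedPiece.mp hx pb.gen)]
    split_ifs with h
    · subst h
      rw [show algebraMap Fqd k pb.gen ^ Fintype.card Fq ^ (i + 1 : ℕ) = v i from rfl,
        Lagrange.eval_basis_self hv.injOn (Finset.mem_univ i), one_smul]
    · rw [show algebraMap Fqd k pb.gen ^ Fintype.card Fq ^ (j + 1 : ℕ) = v j from rfl,
        Lagrange.eval_basis_of_ne h (Finset.mem_univ j), zero_smul]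

end Grading

/-! ## Adapted bases -/

section RootOfX

variable {k : Type*} [Field k] {M : Type*} [AddCommGroup M] [Module k⟦X⟧ M]
  [Module.Free k⟦X⟧ M] [Module.Finite k⟦X⟧ M]
variable {d : ℕ} {P : Module.End k⟦X⟧ M} (hd : 0 < d)
  (hP : ∀ x, (P ^ d) x = (PowerSeries.X : k⟦X⟧) • x)
include hd hP

theorem injective_of_pow_eq_X : Function.Injective P := by
  have h : Function.Injective (P ^ d) := by
    intro x y hxy
    rw [hP, hP] at hxy
    exact smul_right_injective M PowerSeries.X_ne_zero hxy
  obtain ⟨n, rfl⟩ : ∃ n, d = n + 1 := ⟨d - 1, by omega⟩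
  rw [pow_succ] at h
  intro x y hxy
  apply h
  rw [Module.End.mul_apply, hxy, Module.End.mul_apply]

theorem injective_pow_of_pow_eq_X (n : ℕ) : Function.Injective (P ^ n) := by
  rw [Module.End.coe_pow]
  exact (injective_of_pow_eq_X hd hP).iterate n

/-- Every term with t ≠ s lies in the image of P^{s+1}: for t > s this is clear, and for t < s the
factor X = P^d raises the exponent to t + d ≥ s + 1. Hence P^s(u_s) is in that image, and the
injective P^s cancels. -/
theorem mem_range_of_sum_pow_eq_zero (u : Fin d → M) (hu : ∑ t : Fin d, (P ^ (t : ℕ)) (u t) = 0)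
    (s : Fin d) (hs : ∀ t < s, ∃ w, u t = (PowerSeries.X : k⟦X⟧) • w) : ∃ y, u s = P y := by
  have h1 : ∀ t ∈ Finset.univ.erase s, (P ^ (t : ℕ)) (u t) ∈ LinearMap.range (P ^ (s + 1 : ℕ)) := by
    intro t ht
    rcases lt_or_gt_of_ne (Finset.ne_of_mem_erase ht) with h | h
    · obtain ⟨w, hw⟩ := hs t h
      refine ⟨(P ^ (t + d - (s + 1) : ℕ)) w, ?_⟩
      rw [hw, ← hP, ← Module.End.mul_apply, ← Module.End.mul_apply, ← pow_add, ← pow_add]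
      congr 2
      omega
    · refine ⟨(P ^ (t - (s + 1) : ℕ)) (u t), ?_⟩
      rw [← Module.End.mul_apply, ← pow_add]
      congr 2
      have : (s : ℕ) < t := h
      omega
  rw [← Finset.add_sum_erase _ _ (Finset.mem_univ s)] at hu
  obtain ⟨y, hy⟩ := neg_mem (Submodule.sum_mem _ h1)
  rw [← eq_neg_of_add_eq_zero_left hu, pow_succ, Module.End.mul_apply] at hy
  exact ⟨y, (injective_pow_of_pow_eq_X hd hP _ hy).symm⟩

variable {ι : Type*} [Fintype ι] {e : ι → M}
  (hind : ∀ c : ι → k⟦X⟧, (∃ y, ∑ a, c a • e a = P y) → ∀ a, PowerSeries.X ∣ c a)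
include hind

theorem X_dvd_of_sum_pow_eq_zero (c : Fin d × ι → k⟦X⟧)
    (hc : ∑ i, c i • (P ^ (i.1 : ℕ)) (e i.2) = 0) (i : Fin d × ι) : PowerSeries.X ∣ c i := by
  have hu : ∑ t : Fin d, (P ^ (t : ℕ)) (∑ a, c (t, a) • e a) = 0 := by
    rw [← hc, Fintype.sum_prod_type]
    simp
  have key : ∀ n, ∀ t : Fin d, t.1 = n → ∀ a, PowerSeries.X ∣ c (t, a) := by
    intro n
    induction n using Nat.strong_induction_on with
    | _ n ih =>
      rintro t rfl
      refine hind _ (mem_range_of_sum_pow_eq_zero hd hP _ hu t fun s hs => ?_)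
      choose c' hc' using ih s hs s rfl
      refine ⟨∑ a, c' a • e a, ?_⟩
      simp only [hc', Finset.smul_sum, smul_smul]
  exact key _ i.1 rfl i.2

/-- All coefficients of a relation are divisible by X, and dividing by X leaves a relation.
Iterating, they are divisible by every power of X. -/
theorem linearIndependent_pow_apply :
    LinearIndependent k⟦X⟧ fun i : Fin d × ι => (P ^ (i.1 : ℕ)) (e i.2) := by
  rw [Fintype.linearIndependent_iff]
  have key : ∀ (n : ℕ) (c : Fin d × ι → k⟦X⟧), ∑ i, c i • (P ^ (i.1 : ℕ)) (e i.2) = 0 →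
      ∀ i, PowerSeries.X ^ n ∣ c i := by
    intro n
    induction n with
    | zero => simp
    | succ n ih =>
      intro c hc i
      choose c' hc' using X_dvd_of_sum_pow_eq_zero hd hP hind c hc
      rw [hc' i, pow_succ']
      refine mul_dvd_mul_left _ (ih c' ?_ i)
      apply smul_right_injective M (PowerSeries.X_ne_zero (R := k))
      simp only [smul_zero, Finset.smul_sum, smul_smul, ← hc', hc]
  intro c hc i
  ext n
  exact PowerSeries.X_pow_dvd_iff.mp (key (n + 1) c hc i) n (Nat.lt_succ_self n)

variable (hspan : ∀ x, ∃ (c : ι → k⟦X⟧) (y : M), x = ∑ a, c a • e a + P y)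
include hspan

/-- If `P ^ d = X` and the `e a` form a basis modulo `P`, then the `P ^ t (e a)`, `t < d`, form a
basis. -/
theorem exists_basis_pow_apply : ∃ B : Module.Basis (Fin d × ι) k⟦X⟧ M,
    ∀ t a, B (t, a) = (P ^ (t : ℕ)) (e a) := by
  let v : Fin d × ι → M := fun i => (P ^ (i.1 : ℕ)) (e i.2)
  have hs : Submodule.span k⟦X⟧ (Set.range v) = ⊤ := by
    -- Expanding modulo P n times leaves a remainder in the image of P^n. At n = d this is XM, and
    -- Nakayama's lemma applies.
    have key : ∀ n ≤ d, ∀ x, ∃ w ∈ Submodule.span k⟦X⟧ (Set.range v), ∃ y, x = w + (P ^ n) y := by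
      intro n hn
      induction n with
      | zero => exact fun x => ⟨0, zero_mem _, x, by simp⟩
      | succ n ih =>
        intro x
        obtain ⟨w, hw, y, rfl⟩ := ih (by omega) x
        obtain ⟨c, z, rfl⟩ := hspan y
        refine ⟨w + ∑ a, c a • (P ^ n) (e a), add_mem hw (Submodule.sum_mem _ fun a _ =>
          Submodule.smul_mem _ _ (Submodule.subset_span ⟨(⟨n, by omega⟩, a), rfl⟩)), z, ?_⟩
        rw [map_add, map_sum, pow_succ, Module.End.mul_apply, add_assoc]
        simp only [map_smul]
    refine eq_top_of_sup_X_smul fun x => ?_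
    obtain ⟨w, hw, y, h⟩ := key d le_rfl x
    exact ⟨w, hw, y, by rw [← hP, h]⟩
  exact ⟨Module.Basis.mk (linearIndependent_pow_apply hd hP hind) hs.ge,
    fun t a => by rw [Module.Basis.mk_apply]⟩

end RootOfX

/-! ### Bases of fixed vectors for an exceptional module. -/

section Adapted

variable {Fq k : Type*} [Field Fq] [Fintype Fq] [Field k] [Algebra Fq k]
variable {M : Type*} [AddCommGroup M] [Module k⟦X⟧ M] [Module k M] [IsScalarTower k k⟦X⟧ M]
variable {Fqd : Type*} [Field Fqd] [Finite Fqd] [Algebra Fq Fqd] [Algebra Fqd k]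
  [IsScalarTower Fq Fqd k]
  [Module Fq⟦X⟧ M] [IsScalarTower Fq⟦X⟧ k⟦X⟧ M]
  [Module (MaxOrd Fq Fqd)ᵐᵒᵖ M] [IsScalarTower Fq⟦X⟧ (MaxOrd Fq Fqd)ᵐᵒᵖ M]
  [SMulCommClass (MaxOrd Fq Fqd)ᵐᵒᵖ k⟦X⟧ M]
theorem piEnd_injective [Module.Free k⟦X⟧ M] [Module.Finite k⟦X⟧ M] :
    Function.Injective (piEnd Fq k M Fqd) :=
  injective_of_pow_eq_X Module.finrank_pos piEnd_pow_finrank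

variable [IsAlgClosure Fq k] {φ : M →ₛₗ[frob Fq k] M}

/-- For an exceptional module, `φ = Π ψ` with a bijective Frobenius-semilinear map `ψ`. -/
theorem exists_unit_root_map (hM : IsDieudonneDModule Fqd φ) (hex : IsExceptional Fqd φ) :
    ∃ ψ : M →ₛₗ[frob Fq k] M, Function.Bijective ψ ∧ ∀ x, φ x = piEnd Fq k M Fqd (ψ x) := by
  have := hM.free
  have := hM.finite
  have hinj := piEnd_injective (Fq := Fq) (k := k) (M := M) (Fqd := Fqd)
  have hex' : ∀ x, ∃ y, piEnd Fq k M Fqd y = φ x := fun x =>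
    (Set.ext_iff.mp hex (φ x)).mp ⟨x, rfl⟩
  choose ψ hψ using hex'
  refine ⟨⟨⟨ψ, fun x y => hinj ?_⟩, fun c x => hinj ?_⟩, ⟨fun x y hxy => hM.injective ?_,
    fun y => ?_⟩, fun x => (hψ x).symm⟩
  · rw [hψ, map_add, map_add, hψ, hψ]
  · change piEnd Fq k M Fqd (ψ (c • x)) = piEnd Fq k M Fqd (_ • ψ x)
    rw [hψ, map_smul (piEnd Fq k M Fqd), map_smulₛₗ, hψ]
  · rw [← hψ, ← hψ]
    exact congrArg _ hxy
  · obtain ⟨x, hx⟩ := (Set.ext_iff.mp hex (piEnd Fq k M Fqd y)).mpr ⟨y, rfl⟩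
    exact ⟨x, hinj ((hψ x).trans hx)⟩

/-- This replaces the image of φ_n by M_{n+1} ∩ ΠM, so that bases of the cokernel become bases
modulo Π. A φ-preimage of a homogeneous element is homogeneous. -/
theorem mem_map_gradedPiece (hM : IsDieudonneDModule Fqd φ) (hex : IsExceptional Fqd φ) {n : ℕ}
    {x : M} (hx : x ∈ gradedPiece Fq k M Fqd (n + 1)) :
    x ∈ (gradedPiece Fq k M Fqd n).map φ ↔ ∃ y, x = piEnd Fq k M Fqd y := by
  have h : (∃ y, φ y = x) ↔ ∃ y, piEnd Fq k M Fqd y = x := Set.ext_iff.mp hex x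
  simp only [eq_comm (a := x)]
  rw [← h]
  constructor
  · rintro ⟨y, _, rfl⟩
    exact ⟨y, rfl⟩
  · rintro ⟨y, rfl⟩
    exact ⟨y, mem_gradedPiece_of_map_mem φ hM.map_act hM.injective hx, rfl⟩

/-- Since ψ preserves every graded piece, it commutes with the projections, so the homogeneous
components of a ψ-fixed vector are fixed. -/
theorem span_fixed_gradedPiece (hM : IsDieudonneDModule Fqd φ) (hex : IsExceptional Fqd φ)
    {d : ℕ} (hd : Module.finrank Fq Fqd = d) (i : Fin d) : gradedPiece Fq k M Fqd (i + 1) ≤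
      Submodule.span k⟦X⟧ {x | x ∈ gradedPiece Fq k M Fqd (i + 1) ∧ φ x = piEnd Fq k M Fqd x} := by
  have := hM.free
  have := hM.finite
  have : IsAlgClosed k := IsAlgClosure.isAlgClosed Fq
  have hinj := piEnd_injective (Fq := Fq) (k := k) (M := M) (Fqd := Fqd)
  obtain ⟨ψ, hψ, hφψ⟩ := exists_unit_root_map hM hex
  obtain ⟨p, hp1, hp2, hp3⟩ := exists_gradedProj Fq k M Fqd hd
  have hψmem : ∀ n x, x ∈ gradedPiece Fq k M Fqd n → ψ x ∈ gradedPiece Fq k M Fqd n := by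
    intro n x hx
    apply mem_gradedPiece_of_piEnd_mem hinj
    rw [← hφψ]
    exact map_mem_gradedPiece φ hM.map_act hx
  have hcomm : ∀ x, p i (ψ x) = ψ (p i x) := by
    intro x
    conv_lhs => rw [← hp1 x, map_sum, map_sum]
    rw [Finset.sum_eq_single i]
    · rw [hp3 i i _ (hψmem _ _ (hp2 i x)), if_pos rfl]
    · intro j _ hj
      rw [hp3 i j _ (hψmem _ _ (hp2 j x)), if_neg hj.symm]
    · simp
  intro x hx
  have h1 : x ∈ (Submodule.span k⟦X⟧ {x | ψ x = x}).map (p i) := by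
    rw [span_fixed_eq_top_of_bijective ψ hψ]
    exact ⟨x, trivial, by rw [hp3 i i x hx, if_pos rfl]⟩
  rw [Submodule.map_span] at h1
  refine Submodule.span_mono ?_ h1
  rintro _ ⟨y, hy, rfl⟩
  refine ⟨hp2 i y, ?_⟩
  rw [hφψ, ← hcomm, show ψ y = y from hy]

/-- As π = Π^d kills the cokernel, k⟦π⟧ acts on it through k, and classes of fixed vectors span it
over k. Some of them form a basis, with as many members as the type prescribes. The last two clauses
express spanning and independence modulo ΠM. -/
theorem exists_basis_coker (hM : IsDieudonneDModule Fqd φ) (hex : IsExceptional Fqd φ)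
    {d : ℕ} (hd : Module.finrank Fq Fqd = d) (i : Fin d) :
    ∃ e : Fin (dieudonneType Fqd φ i) → M,
      (∀ s, e s ∈ gradedPiece Fq k M Fqd (i + 1) ∧ φ (e s) = piEnd Fq k M Fqd (e s)) ∧
      (∀ x ∈ gradedPiece Fq k M Fqd (i + 1), ∃ (c : Fin (dieudonneType Fqd φ i) → k⟦X⟧) (y : M),
        x = ∑ s, c s • e s + piEnd Fq k M Fqd y) ∧
      ∀ c : Fin (dieudonneType Fqd φ i) → k⟦X⟧, (∃ y, ∑ s, c s • e s = piEnd Fq k M Fqd y) →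
        ∀ s, PowerSeries.X ∣ c s := by
  have := hM.free
  have := hM.finite
  have hdpos : 0 < Module.finrank Fq Fqd := Module.finrank_pos
  let Q := ((gradedPiece Fq k M Fqd i).map φ).submoduleOf (gradedPiece Fq k M Fqd (i + 1))
  have hQ : ∀ z : gradedPiece Fq k M Fqd (i + 1), z ∈ Q ↔ ∃ y, z.1 = piEnd Fq k M Fqd y :=
    fun z => mem_map_gradedPiece hM hex z.2
  have hX : ∀ v : gradedPiece Fq k M Fqd (i + 1) ⧸ Q, (PowerSeries.X : k⟦X⟧) • v = 0 := by
    intro v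
    induction v using Submodule.Quotient.induction_on with
    | H v =>
    rw [← Submodule.Quotient.mk_smul, Submodule.Quotient.mk_eq_zero, hQ]
    refine ⟨(piEnd Fq k M Fqd ^ (Module.finrank Fq Fqd - 1)) v.1, ?_⟩
    rw [← Module.End.mul_apply, ← pow_succ', Nat.sub_add_cancel hdpos, piEnd_pow_finrank]
    rfl
  have hfin : Module.Finite k (gradedPiece Fq k M Fqd (i + 1) ⧸ Q) := finite_of_X_smul_eq_zero hX
  let S : Set (gradedPiece Fq k M Fqd (i + 1) ⧸ Q) :=
    {v | ∃ z : gradedPiece Fq k M Fqd (i + 1), φ z = piEnd Fq k M Fqd z ∧ Q.mkQ z = v}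
  have hS : ⊤ ≤ Submodule.span k S := by
    intro v _
    induction v using Submodule.Quotient.induction_on with
    | H v =>
    have key : ∀ (x : M), x ∈ Submodule.span k⟦X⟧ {x | x ∈ gradedPiece Fq k M Fqd (i + 1) ∧
        φ x = piEnd Fq k M Fqd x} → ∃ hx : x ∈ gradedPiece Fq k M Fqd (i + 1),
        Q.mkQ ⟨x, hx⟩ ∈ Submodule.span k S := by
      intro x hx
      induction hx using Submodule.closure_induction with
      | zero => exact ⟨zero_mem _, by
          rw [show (⟨0, zero_mem _⟩ : gradedPiece Fq k M Fqd (i + 1)) = 0 from rfl, map_zero]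
          exact zero_mem _⟩
      | add x y _ _ hx hy =>
        obtain ⟨hx, hx'⟩ := hx
        obtain ⟨hy, hy'⟩ := hy
        exact ⟨add_mem hx hy, add_mem hx' hy'⟩
      | smul_mem c x hx =>
        refine ⟨Submodule.smul_mem _ _ hx.1, ?_⟩
        have : Q.mkQ ⟨c • x, Submodule.smul_mem _ _ hx.1⟩ = c • Q.mkQ ⟨x, hx.1⟩ := rfl
        rw [this, smul_eq_constantCoeff_smul (hX _)]
        exact Submodule.smul_mem _ _ (Submodule.subset_span ⟨⟨x, hx.1⟩, hx.2, rfl⟩)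
    exact (key v.1 (span_fixed_gradedPiece hM hex hd i v.2)).2
  let b₀ := Module.Basis.ofSpan hS
  have hfr : Module.finrank k (gradedPiece Fq k M Fqd (i + 1) ⧸ Q) = dieudonneType Fqd φ i := rfl
  let b := b₀.reindex (b₀.indexEquiv (Module.finBasisOfFinrankEq _ _ hfr))
  have hb : ∀ s, ∃ z : gradedPiece Fq k M Fqd (i + 1), φ z = piEnd Fq k M Fqd z ∧
      Q.mkQ z = b s := fun s => Module.Basis.ofSpan_subset hS (by
    rw [Module.Basis.reindex_apply]
    exact Set.mem_range_self _)
  choose z hz1 hz2 using hb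
  refine ⟨fun s => z s, fun s => ⟨(z s).2, hz1 s⟩, fun x hx => ?_, fun c hc s => ?_⟩
  · have h1 := b.sum_repr (Q.mkQ ⟨x, hx⟩)
    simp only [← hz2, ← C_smul_eq_smul, ← map_smul, ← map_sum] at h1
    rw [eq_comm, Submodule.mkQ_apply, Submodule.mkQ_apply, Submodule.Quotient.eq, hQ] at h1
    obtain ⟨y, hy⟩ := h1
    refine ⟨fun s => PowerSeries.C (b.repr (Q.mkQ ⟨x, hx⟩) s), y, ?_⟩
    rw [← hy]
    simp
  · have h1 : ∑ s, PowerSeries.constantCoeff (c s) • b s = 0 := by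
      simp only [← hz2, ← smul_eq_constantCoeff_smul (hX _), ← map_smul, ← map_sum]
      rw [Submodule.mkQ_apply, Submodule.Quotient.mk_eq_zero, hQ]
      obtain ⟨y, hy⟩ := hc
      refine ⟨y, ?_⟩
      rw [← hy]
      simp
    rw [PowerSeries.X_dvd_iff]
    exact Fintype.linearIndependent_iff.mp b.linearIndependent _ h1 s

/-- The module has homogeneous vectors `e a` fixed by `Π⁻¹ φ` such that the `Π ^ t (e a)` form a
basis; they lift bases of the cokernels of the `φ_i`. -/
theorem exists_adaptedBasis (hM : IsDieudonneDModule Fqd φ) (hex : IsExceptional Fqd φ)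
    {d : ℕ} (hd : Module.finrank Fq Fqd = d) (f : Fin d → ℕ)
    (hf : ∀ i : Fin d, f i = dieudonneType Fqd φ i) :
    ∃ (e : (Σ i : Fin d, Fin (f i)) → M)
      (B : Module.Basis (Fin d × Σ i : Fin d, Fin (f i)) k⟦X⟧ M),
      (∀ a, e a ∈ gradedPiece Fq k M Fqd (a.1 + 1)) ∧
      (∀ a, φ (e a) = piEnd Fq k M Fqd (e a)) ∧
      ∀ t a, B (t, a) = (piEnd Fq k M Fqd ^ (t : ℕ)) (e a) := by
  obtain rfl : f = fun i : Fin d => dieudonneType Fqd φ i := funext hf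
  have := hM.free
  have := hM.finite
  have hdpos : 0 < d := hd ▸ Module.finrank_pos
  choose e he hspan hind using exists_basis_coker hM hex hd
  obtain ⟨p, hp1, hp2, hp3⟩ := exists_gradedProj Fq k M Fqd hd
  have hprange : ∀ i y, ∃ z, p i (piEnd Fq k M Fqd y) = piEnd Fq k M Fqd z := by
    intro i y
    suffices H : p i (piEnd Fq k M Fqd y) ∈ LinearMap.range (piEnd Fq k M Fqd) by
      obtain ⟨z, hz⟩ := H
      exact ⟨z, hz.symm⟩
    rw [← hp1 y, map_sum, map_sum]
    refine Submodule.sum_mem _ fun j _ => ?_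
    -- Π moves degree j + 1 to j + 2, which modulo d is l + 1 for l = (j + 1) mod d. So Π permutes
    -- the pieces cyclically and the projections preserve ΠM.
    obtain ⟨l, hl⟩ : ∃ l : Fin d, (j + 1 + 1 : ℕ) ≡ l + 1 [MOD Module.finrank Fq Fqd] :=
      ⟨⟨(j + 1) % d, Nat.mod_lt _ hdpos⟩, by
        rw [hd]
        exact ((Nat.mod_modEq _ _).add_right 1).symm⟩
    have hmem := piEnd_mem (hp2 j y)
    rw [gradedPiece_congr hl] at hmem
    rw [hp3 i l _ hmem]
    split_ifs
    · exact ⟨_, rfl⟩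
    · exact zero_mem _
  obtain ⟨B, hB⟩ := exists_basis_pow_apply (P := piEnd Fq k M Fqd)
    (e := fun a : Σ i : Fin d, Fin (dieudonneType Fqd φ i) => e a.1 a.2) hdpos
    (fun x => hd ▸ piEnd_pow_finrank x) (fun c hc a => by
      obtain ⟨y, hy⟩ := hc
      have h1 := congrArg (p a.1) hy
      rw [map_sum, Fintype.sum_sigma, Finset.sum_eq_single a.1] at h1
      · simp only [map_smul, hp3 a.1 a.1 _ (he a.1 _).1, if_true] at h1
        obtain ⟨z, hz⟩ := hprange a.1 y
        exact hind a.1 (fun s => c ⟨a.1, s⟩) ⟨z, h1.trans hz⟩ a.2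
      · intro j _ hj
        refine Finset.sum_eq_zero fun s _ => ?_
        rw [map_smul, hp3 a.1 j _ (he j s).1, if_neg hj.symm, smul_zero]
      · simp) (fun x => by
      choose c y hcy using fun i => hspan i (p i x) (hp2 i x)
      refine ⟨fun a => c a.1 a.2, ∑ i, y i, ?_⟩
      conv_lhs => rw [← hp1 x]
      rw [Fintype.sum_sigma, map_sum, ← Finset.sum_add_distrib]
      exact Finset.sum_congr rfl fun i _ => hcy i)
  exact ⟨_, B, fun a => (he a.1 a.2).1, fun a => (he a.1 a.2).2, hB⟩

end Adapted

/-! ## The endomorphism ring -/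

theorem exists_algebraMap_eq_of_pow_card_eq {F E : Type*} [Field F] [Fintype F] [Field E]
    [Algebra F E] {c : E} (hc : c ^ Fintype.card F = c) : ∃ r : F, algebraMap F E r = c := by
  classical
  have h1 : (∏ a : F, (Polynomial.X - Polynomial.C a)) =
      (Polynomial.X ^ Fintype.card F - Polynomial.X : Polynomial F) := by
    have := Polynomial.prod_multiset_X_sub_C_of_monic_of_roots_card_eq
      (p := (Polynomial.X ^ Fintype.card F - Polynomial.X : Polynomial F))
      (Polynomial.monic_X_pow_sub (by
        rw [Polynomial.degree_X]
        exact_mod_cast Fintype.one_lt_card))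
      (by
        rw [FiniteField.roots_X_pow_card_sub_X,
          FiniteField.X_pow_card_sub_X_natDegree_eq _ Fintype.one_lt_card]
        rfl)
    rw [FiniteField.roots_X_pow_card_sub_X] at this
    exact this
  have h2 := congrArg (fun p => Polynomial.aeval c p) h1
  simp only [map_prod, map_sub, map_pow, Polynomial.aeval_X, Polynomial.aeval_C, hc,
    sub_self] at h2
  obtain ⟨a, _, ha⟩ := Finset.prod_eq_zero_iff.mp h2
  exact ⟨a, (sub_eq_zero.mp ha).symm⟩

section EndRing

variable {Fq k : Type*} [Field Fq] [Fintype Fq] [Field k] [Algebra Fq k]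

theorem exists_algebraMap_eq_of_frob_eq {c : k⟦X⟧} (hc : frob Fq k c = c) :
    ∃ r : Fq⟦X⟧, algebraMap Fq⟦X⟧ k⟦X⟧ r = c := by
  have h : ∀ n, ∃ r : Fq, algebraMap Fq k r = PowerSeries.coeff n c := fun n =>
    exists_algebraMap_eq_of_pow_card_eq (by
      conv_rhs => rw [← hc]
      simp [frob])
  choose r hr using h
  refine ⟨PowerSeries.mk r, ?_⟩
  ext n
  rw [PowerSeries.algebraMap_apply'', PowerSeries.coeff_map, PowerSeries.coeff_mk, hr]

theorem algebraMap_powerSeries_injective :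
    Function.Injective (algebraMap Fq⟦X⟧ k⟦X⟧) := by
  have : (algebraMap Fq⟦X⟧ k⟦X⟧ : Fq⟦X⟧ → k⟦X⟧) = PowerSeries.map (algebraMap Fq k) :=
    funext fun r => PowerSeries.algebraMap_apply'' ..
  rw [this]
  exact PowerSeries.map_injective _ (algebraMap Fq k).injective

theorem algebraMap_powerSeries_X :
    algebraMap Fq⟦X⟧ k⟦X⟧ PowerSeries.X = PowerSeries.X := by
  rw [PowerSeries.algebraMap_apply'', PowerSeries.map_X]

theorem X_dvd_of_X_dvd_algebraMap {r : Fq⟦X⟧}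
    (h : PowerSeries.X ∣ algebraMap Fq⟦X⟧ k⟦X⟧ r) : PowerSeries.X ∣ r := by
  rw [PowerSeries.X_dvd_iff] at h ⊢
  rw [PowerSeries.algebraMap_apply'', ← PowerSeries.coeff_zero_eq_constantCoeff_apply,
    PowerSeries.coeff_map, PowerSeries.coeff_zero_eq_constantCoeff_apply] at h
  exact (algebraMap Fq k).injective (by rw [h, map_zero])

variable {M : Type*} [AddCommGroup M] [Module k⟦X⟧ M] [Module k M] [IsScalarTower k k⟦X⟧ M]
variable {Fqd : Type*} [Field Fqd] [Finite Fqd] [Algebra Fq Fqd] [Algebra Fqd k]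
  [IsScalarTower Fq Fqd k]
  [Module Fq⟦X⟧ M] [IsScalarTower Fq⟦X⟧ k⟦X⟧ M]
  [Module (MaxOrd Fq Fqd)ᵐᵒᵖ M] [IsScalarTower Fq⟦X⟧ (MaxOrd Fq Fqd)ᵐᵒᵖ M]
  [SMulCommClass (MaxOrd Fq Fqd)ᵐᵒᵖ k⟦X⟧ M]

/-- An endomorphism commuting with `Π` and the constants commutes with the maximal order. -/
theorem map_act_of_commute [Module.Free k⟦X⟧ M] [Module.Finite k⟦X⟧ M] (g : Module.End k⟦X⟧ M)
    (hpi : ∀ x, g (piEnd Fq k M Fqd x) = piEnd Fq k M Fqd (g x))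
    (hconst : ∀ c x, g (constEnd Fq k M Fqd c x) = constEnd Fq k M Fqd c (g x))
    (δ : MaxOrd Fq Fqd) (x : M) : g (op δ • x) = op δ • g x := by
  -- Writing δ = c + εΠ with c constant, the failure of g to commute with δ is Π applied to its
  -- failure for ε. Hence it is divisible by every power of Π and vanishes.
  have hpi' : ∀ n, ∀ δ : MaxOrd Fq Fqd, ∃ y : M,
      g (op δ • x) - op δ • g x = (piEnd Fq k M Fqd ^ n) y := by
    intro n
    induction n with
    | zero => exact fun δ => ⟨_, rfl⟩
    | succ n ih =>
      intro δ
      obtain ⟨ε, hε⟩ := δ.eq_const_add_mul_varPi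
      obtain ⟨y, hy⟩ := ih ε
      refine ⟨y, ?_⟩
      rw [pow_succ', Module.End.mul_apply, ← hy, hε, op_add, op_mul, add_smul, add_smul, mul_smul,
        mul_smul, map_add, map_sub, ← hpi]
      simp only [← constEnd_apply (k := k), ← piEnd_apply (k := k), hconst]
      abel
  rw [← sub_eq_zero]
  refine eq_zero_of_forall_X_pow_smul (k := k) fun n => ?_
  obtain ⟨y, hy⟩ := hpi' (Module.finrank Fq Fqd * n) δ
  refine ⟨y, ?_⟩
  rw [hy]
  clear hy
  induction n with
  | zero => simp
  | succ n ih =>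
    rw [mul_add, mul_one, add_comm, pow_add, Module.End.mul_apply, ih, piEnd_pow_finrank, smul_smul,
      ← pow_succ']

variable {d : ℕ} {f : Fin d → ℕ}

variable (Fq k Fqd) in
/-- The vectors `Π ^ (d - 1 - i) (e a)`, for `a` in the `i`-th block. -/
noncomputable def topVec (e : (Σ i : Fin d, Fin (f i)) → M) (a : Σ i : Fin d, Fin (f i)) : M :=
  (piEnd Fq k M Fqd ^ (d - 1 - a.1 : ℕ)) (e a)

variable {φ : M →ₛₗ[frob Fq k] M}
  (hφ : ∀ (δ : MaxOrd Fq Fqd) (x : M), φ (op δ • x) = op δ • φ x)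
variable (hd : Module.finrank Fq Fqd = d) {e : (Σ i : Fin d, Fin (f i)) → M}
  {B : Module.Basis (Fin d × Σ i : Fin d, Fin (f i)) k⟦X⟧ M}
  (he : ∀ a, e a ∈ gradedPiece Fq k M Fqd (a.1 + 1))
  (hφe : ∀ a, φ (e a) = piEnd Fq k M Fqd (e a))
  (hB : ∀ t a, B (t, a) = (piEnd Fq k M Fqd ^ (t : ℕ)) (e a))

include hφ in
theorem map_piEnd_pow (t : ℕ) (x : M) :
    φ ((piEnd Fq k M Fqd ^ t) x) = (piEnd Fq k M Fqd ^ t) (φ x) := by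
  induction t with
  | zero => rfl
  | succ t ih =>
    rw [pow_succ', Module.End.mul_apply, Module.End.mul_apply, piEnd_apply, hφ, ih, piEnd_apply]

theorem piEnd_comm (t : ℕ) (x : M) :
    (piEnd Fq k M Fqd ^ t) (piEnd Fq k M Fqd x) = piEnd Fq k M Fqd ((piEnd Fq k M Fqd ^ t) x) := by
  rw [← Module.End.mul_apply, ← pow_succ, pow_succ', Module.End.mul_apply]

include hφ hφe in
theorem map_topVec (a : Σ i : Fin d, Fin (f i)) :
    φ (topVec Fq k Fqd e a) = piEnd Fq k M Fqd (topVec Fq k Fqd e a) := by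
  rw [topVec, map_piEnd_pow hφ, hφe, piEnd_comm]

include hd in
theorem piEnd_pow_eq (x : M) : (piEnd Fq k M Fqd ^ d) x = (PowerSeries.X : k⟦X⟧) • x := by
  rw [← hd, piEnd_pow_finrank]

include hB in
theorem topVec_eq (b : Σ i : Fin d, Fin (f i)) :
    topVec Fq k Fqd e b = B (⟨d - 1 - b.1, by have := b.1.2; omega⟩, b) := by
  rw [hB, topVec]

include hB in
theorem linearIndependent_topVec : LinearIndependent k⟦X⟧ (topVec Fq k Fqd e) := by
  let ι : (Σ i : Fin d, Fin (f i)) → Fin d × Σ i : Fin d, Fin (f i) := fun a =>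
    (⟨d - 1 - a.1, by have := a.1.2; omega⟩, a)
  have h : topVec Fq k Fqd e = B ∘ ι := by
    funext a
    exact topVec_eq hB a
  rw [h]
  exact B.linearIndependent.comp ι fun a b hab => (Prod.ext_iff.mp hab).2

include hB in
theorem topVec_coeff_ext {c c' : (Σ i : Fin d, Fin (f i)) → k⟦X⟧}
    (h : ∑ a, c a • topVec Fq k Fqd e a = ∑ a, c' a • topVec Fq k Fqd e a) : c = c' := by
  rw [← sub_eq_zero, ← Finset.sum_sub_distrib] at h
  simp only [← sub_smul] at h
  funext a
  exact sub_eq_zero.mp (Fintype.linearIndependent_iff.mp (linearIndependent_topVec hB) _ h a)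

-- The vector Π^t e_a has degree a.1 + 1 + t, congruent to d exactly when t = d - 1 - a.1.
-- Projection to M_d therefore kills all basis vectors except the `topVec`s.
include hd he hB in
theorem exists_topVec_coeff {x : M} (hx : x ∈ gradedPiece Fq k M Fqd d) :
    ∃ c : (Σ i : Fin d, Fin (f i)) → k⟦X⟧, x = ∑ a, c a • topVec Fq k Fqd e a := by
  have hdpos : 0 < d := hd ▸ Module.finrank_pos
  obtain ⟨p, hp1, hp2, hp3⟩ := exists_gradedProj Fq k M Fqd hd
  let l : Fin d := ⟨d - 1, by omega⟩
  have hl : (l + 1 : ℕ) = d := Nat.sub_add_cancel hdpos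
  have h1 : p l x = x := by
    rw [hp3 l l x (by rwa [hl]), if_pos rfl]
  refine ⟨fun a => B.repr x (⟨d - 1 - a.1, by omega⟩, a), ?_⟩
  have key : ∀ (t : Fin d) (a : Σ i : Fin d, Fin (f i)),
      p l (B (t, a)) = if t = ⟨d - 1 - a.1, by omega⟩ then topVec Fq k Fqd e a else 0 := by
    intro t a
    have hmem := piEnd_pow_mem (he a) t
    rw [← hB, gradedPiece_congr (n := (a.1 + t) % d + 1) (by
      rw [hd, add_right_comm]
      exact ((Nat.mod_modEq _ _).add_right 1).symm)] at hmem
    rw [hp3 l ⟨(a.1 + t) % d, Nat.mod_lt _ hdpos⟩ _ hmem]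
    have ha := a.1.2
    have ht := t.2
    have hiff : l = ⟨(a.1 + t) % d, Nat.mod_lt _ hdpos⟩ ↔ t = ⟨d - 1 - a.1, by omega⟩ := by
      simp only [l, Fin.ext_iff]
      rcases lt_or_ge (a.1 + t : ℕ) d with h | h
      · rw [Nat.mod_eq_of_lt h]
        omega
      · rw [Nat.mod_eq_sub_mod h, Nat.mod_eq_of_lt (by omega)]
        omega
    by_cases h : t = ⟨d - 1 - a.1, by omega⟩
    · rw [if_pos (hiff.mpr h), if_pos h, hB, h, topVec]
    · rw [if_neg fun h' => h (hiff.mp h'), if_neg h]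
  conv_lhs => rw [← h1, ← B.sum_repr x, map_sum, Fintype.sum_prod_type_right]
  refine Finset.sum_congr rfl fun a _ => ?_
  simp only [map_smul, key]
  simp

-- Applying Π^s moves a basis vector from position t' to position s + t' ≥ s unless s + t' ≥ d, in
-- which case a factor X = Π^d splits off.
include hd hB in
theorem X_dvd_repr_piEnd_pow (s : ℕ) (y : M) (t : Fin d) (ht : (t : ℕ) < s)
    (a : Σ i : Fin d, Fin (f i)) :
    PowerSeries.X ∣ B.repr ((piEnd Fq k M Fqd ^ s) y) (t, a) := by
  rw [← B.sum_repr y, map_sum, map_sum, Finsupp.finsetSum_apply]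
  refine Finset.dvd_sum fun i _ => ?_
  rw [map_smul, map_smul, Finsupp.smul_apply, smul_eq_mul]
  apply Dvd.dvd.mul_left
  obtain ⟨t', a'⟩ := i
  rw [hB, ← Module.End.mul_apply, ← pow_add]
  rcases lt_or_ge (s + t' : ℕ) d with h | h
  · rw [show (piEnd Fq k M Fqd ^ (s + t' : ℕ)) (e a') = B (⟨s + t', h⟩, a') from
      (hB ⟨s + t', h⟩ a').symm,
      B.repr_self, Finsupp.single_apply, if_neg]
    · exact dvd_zero _
    · intro h'
      have := congrArg (fun z => (z.1 : ℕ)) h'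
      simp at this
      omega
  · rw [← Nat.add_sub_cancel' h, pow_add, Module.End.mul_apply, piEnd_pow_eq hd, map_smul,
      Finsupp.smul_apply, smul_eq_mul]
    exact dvd_mul_right _ _

include hd hB in
theorem X_dvd_of_sum_topVec_eq {c : (Σ i : Fin d, Fin (f i)) → k⟦X⟧} {s : ℕ} {y : M}
    (h : ∑ a, c a • topVec Fq k Fqd e a = (piEnd Fq k M Fqd ^ s) y) (a : Σ i : Fin d, Fin (f i))
    (ha : d - 1 - a.1 < s) : PowerSeries.X ∣ c a := by
  have h1 := X_dvd_repr_piEnd_pow hd hB s y ⟨d - 1 - a.1, by have := a.1.2; omega⟩ ha a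
  rw [← h] at h1
  rw [map_sum, Finsupp.finsetSum_apply, Finset.sum_eq_single a] at h1
  · simpa [topVec_eq hB] using h1
  · intro b _ hb
    rw [topVec_eq hB, map_smul, B.repr_self, Finsupp.smul_apply, Finsupp.single_apply, if_neg, smul_zero]
    exact fun h' => hb (Prod.ext_iff.mp h').2
  · simp

-- As g commutes with Π and φ, and the `topVec`s are fixed, Frobenius fixes the coefficients, so
-- they lie in R. Since g(Π^{d-1-i} e_b) = Π^{d-1-i} g(e_b) for b in block i, the coefficients at
-- later blocks, where the power of Π is smaller, are divisible by π.
include hφ hφe hd he hB in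
theorem exists_matrix_of_end {g : Module.End k⟦X⟧ M} (hg : g ∈ dieudonneEnd Fqd φ) :
    ∃ m ∈ stdHereditaryOrder (PowerSeries.X : Fq⟦X⟧) f, ∀ b, g (topVec Fq k Fqd e b) =
      ∑ a, algebraMap Fq⟦X⟧ k⟦X⟧ (m b a) • topVec Fq k Fqd e a := by
  have := Module.Free.of_basis B
  have := Module.Finite.of_basis B
  have hgpi : ∀ t x, g ((piEnd Fq k M Fqd ^ t) x) = (piEnd Fq k M Fqd ^ t) (g x) := by
    intro t x
    induction t with
    | zero => rfl
    | succ t ih =>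
      rw [pow_succ', Module.End.mul_apply, Module.End.mul_apply, piEnd_apply, hg.2, ih, piEnd_apply]
  have hgmem : ∀ n x, x ∈ gradedPiece Fq k M Fqd n → g x ∈ gradedPiece Fq k M Fqd n := by
    intro n x hx
    rw [mem_gradedPiece] at hx ⊢
    intro c
    rw [constEnd_apply, ← hg.2, ← constEnd_apply (k := k), hx, ← C_smul_eq_smul, map_smul,
      C_smul_eq_smul]
  have hmem : ∀ b, g (topVec Fq k Fqd e b) ∈ gradedPiece Fq k M Fqd d := by
    intro b
    apply hgmem
    have h := piEnd_pow_mem (he b) (d - 1 - b.1)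
    rwa [show (b.1 + 1 + (d - 1 - b.1) : ℕ) = d by have := b.1.2; omega] at h
  choose c hc using fun b => exists_topVec_coeff hd he hB (hmem b)
  have hfix : ∀ b a, frob Fq k (c b a) = c b a := by
    intro b
    suffices H : (fun a => frob Fq k (c b a)) = c b from fun a => congrFun H a
    apply topVec_coeff_ext hB
    apply piEnd_injective (Fq := Fq) (k := k) (M := M) (Fqd := Fqd)
    have h1 := hg.1 (topVec Fq k Fqd e b)
    rw [map_topVec hφ hφe, show g (piEnd Fq k M Fqd _) = piEnd Fq k M Fqd (g _) from hg.2 _ _,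
      hc b] at h1
    rw [h1, map_sum, map_sum]
    simp only [map_smulₛₗ, map_topVec hφ hφe, RingHom.id_apply]
  choose m hm using fun b a => exists_algebraMap_eq_of_frob_eq (hfix b a)
  refine ⟨Matrix.of m, ?_, fun b => ?_⟩
  · rw [mem_stdHereditaryOrder]
    intro b a hba
    apply X_dvd_of_X_dvd_algebraMap (k := k)
    rw [Matrix.of_apply, hm]
    refine X_dvd_of_sum_topVec_eq hd hB (s := d - 1 - b.1) (y := g (e b)) ?_ a ?_
    · rw [← hc, topVec, hgpi]
    · have : (b.1 : ℕ) < a.1 := hba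
      have := a.1.2
      omega
  · rw [hc b]
    simp [hm]

-- Here w is the contribution of one matrix entry to the image of e_b. If the block of a is not
-- after that of b, take r Π^{b-a} e_a with block indices in the exponent. Otherwise the exponent is
-- negative, and the factor π = Π^d of r makes up for it.
include hφ hφe hd he in
theorem exists_lift_topVec (a b : Σ i : Fin d, Fin (f i)) (r : Fq⟦X⟧)
    (hr : b.1 < a.1 → PowerSeries.X ∣ r) :
    ∃ w ∈ gradedPiece Fq k M Fqd (b.1 + 1), φ w = piEnd Fq k M Fqd w ∧
      (piEnd Fq k M Fqd ^ (d - 1 - b.1 : ℕ)) w = algebraMap Fq⟦X⟧ k⟦X⟧ r • topVec Fq k Fqd e a := by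
  have ha := a.1.2
  have hb := b.1.2
  have hfix : ∀ (r : Fq⟦X⟧) (t : ℕ),
      φ (algebraMap Fq⟦X⟧ k⟦X⟧ r • (piEnd Fq k M Fqd ^ t) (e a)) =
        piEnd Fq k M Fqd (algebraMap Fq⟦X⟧ k⟦X⟧ r • (piEnd Fq k M Fqd ^ t) (e a)) := by
    intro r t
    rw [map_smulₛₗ, frob_algebraMap, map_piEnd_pow hφ, hφe, piEnd_comm, map_smul]
  rcases lt_or_ge b.1 a.1 with h | h
  · obtain ⟨r, rfl⟩ := hr h
    have h' : (b.1 : ℕ) < a.1 := h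
    refine ⟨algebraMap Fq⟦X⟧ k⟦X⟧ r • (piEnd Fq k M Fqd ^ (d + b.1 - a.1 : ℕ)) (e a),
      Submodule.smul_mem _ _ ?_, hfix _ _, ?_⟩
    · rw [gradedPiece_congr (n := a.1 + 1 + (d + b.1 - a.1)) (by
        rw [hd, show (a.1 + 1 + (d + b.1 - a.1) : ℕ) = b.1 + 1 + d by omega]
        simp [Nat.ModEq])]
      exact piEnd_pow_mem (he a) _
    · rw [map_smul, ← Module.End.mul_apply, ← pow_add,
        show (d - 1 - b.1 + (d + b.1 - a.1) : ℕ) = d + (d - 1 - a.1) by omega, pow_add,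
        Module.End.mul_apply, ← topVec, piEnd_pow_eq hd, map_mul, algebraMap_powerSeries_X,
        smul_smul, mul_comm]
  · have h' : (a.1 : ℕ) ≤ b.1 := h
    refine ⟨algebraMap Fq⟦X⟧ k⟦X⟧ r • (piEnd Fq k M Fqd ^ (b.1 - a.1 : ℕ)) (e a),
      Submodule.smul_mem _ _ ?_, hfix _ _, ?_⟩
    · rw [show (b.1 + 1 : ℕ) = a.1 + 1 + (b.1 - a.1) by omega]
      exact piEnd_pow_mem (he a) _
    · rw [map_smul, ← Module.End.mul_apply, ← pow_add,
        show (d - 1 - b.1 + (b.1 - a.1) : ℕ) = d - 1 - a.1 by omega, topVec]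

-- Sending e_b to the sum of its lifts and extending by powers of Π defines g. The lifts have the
-- degree of e_b, so g commutes with the constants, and they are fixed, so g commutes with φ.
include hφ hφe hd he hB in
theorem exists_end_of_matrix {m : Matrix (Σ i : Fin d, Fin (f i)) (Σ i : Fin d, Fin (f i)) Fq⟦X⟧}
    (hm : m ∈ stdHereditaryOrder (PowerSeries.X : Fq⟦X⟧) f) :
    ∃ g ∈ dieudonneEnd Fqd φ, ∀ b, g (topVec Fq k Fqd e b) =
      ∑ a, algebraMap Fq⟦X⟧ k⟦X⟧ (m b a) • topVec Fq k Fqd e a := by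
  have := Module.Free.of_basis B
  have := Module.Finite.of_basis B
  have hdpos : 0 < d := hd ▸ Module.finrank_pos
  choose w hw1 hw2 hw3 using fun b a => exists_lift_topVec hφ hd he hφe a b (m b a)
    (mem_stdHereditaryOrder.mp hm b a)
  let g : Module.End k⟦X⟧ M :=
    B.constr k⟦X⟧ fun i => (piEnd Fq k M Fqd ^ (i.1 : ℕ)) (∑ a, w i.2 a)
  have hgB : ∀ t b, g (B (t, b)) = (piEnd Fq k M Fqd ^ (t : ℕ)) (∑ a, w b a) := fun t b => by
    simp only [g, Module.Basis.constr_basis]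
  have hpow : ∀ (t : ℕ) (x : M), piEnd Fq k M Fqd ((piEnd Fq k M Fqd ^ t) x) =
      (piEnd Fq k M Fqd ^ (t + 1)) x := fun t x => by
    rw [pow_succ', Module.End.mul_apply]
  have hgpi : ∀ x, g (piEnd Fq k M Fqd x) = piEnd Fq k M Fqd (g x) := by
    intro x
    suffices H : g ∘ₗ piEnd Fq k M Fqd = piEnd Fq k M Fqd ∘ₗ g from LinearMap.congr_fun H x
    refine B.ext fun ⟨t, b⟩ => ?_
    rw [LinearMap.comp_apply, LinearMap.comp_apply, hgB, hB, hpow, hpow]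
    -- At the last exponent Π leaves the basis and wraps around to X times the vector at exponent 0.
    rcases Nat.lt_or_ge (t + 1 : ℕ) d with h | h
    · rw [show (piEnd Fq k M Fqd ^ (t + 1 : ℕ)) (e b) = B (⟨t + 1, h⟩, b) from
        (hB ⟨t + 1, h⟩ b).symm, hgB]
    · have ht : (t + 1 : ℕ) = Module.finrank Fq Fqd := by omega
      rw [ht, piEnd_pow_finrank, piEnd_pow_finrank, map_smul,
        show e b = B (⟨0, hdpos⟩, b) by rw [hB]; rfl, hgB]
      rfl
  have hgconst : ∀ c x, g (constEnd Fq k M Fqd c x) = constEnd Fq k M Fqd c (g x) := by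
    intro c x
    suffices H : g ∘ₗ constEnd Fq k M Fqd c = constEnd Fq k M Fqd c ∘ₗ g from
      LinearMap.congr_fun H x
    refine B.ext fun ⟨t, b⟩ => ?_
    have h1 := mem_gradedPiece.mp (piEnd_pow_mem (he b) t) c
    have h2 := mem_gradedPiece.mp (piEnd_pow_mem
      (Submodule.sum_mem _ fun a (_ : a ∈ Finset.univ) => hw1 b a) t) c
    rw [← hB] at h1
    rw [LinearMap.comp_apply, LinearMap.comp_apply, h1, ← C_smul_eq_smul, map_smul, hgB, h2,
      C_smul_eq_smul]
  have hgφ : ∀ x, g (φ x) = φ (g x) := by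
    intro x
    suffices H : g.comp φ = φ.comp g from LinearMap.congr_fun H x
    refine B.ext fun ⟨t, b⟩ => ?_
    rw [LinearMap.comp_apply, LinearMap.comp_apply, hgB, map_piEnd_pow hφ, map_sum,
      Finset.sum_congr rfl fun a _ => hw2 b a, ← map_sum, hB, map_piEnd_pow hφ, hφe, piEnd_comm,
      hgpi, ← hB, hgB, piEnd_comm]
  refine ⟨g, ⟨hgφ, map_act_of_commute g hgpi hgconst⟩, fun b => ?_⟩
  rw [topVec_eq hB, hgB, map_sum]
  exact Finset.sum_congr rfl fun a _ => hw3 b a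

include hφ hφe hd he hB in
/-- The endomorphism algebra is anti-isomorphic to the standard order. -/
theorem nonempty_algEquiv_op : Nonempty (dieudonneEnd Fqd φ ≃ₐ[Fq⟦X⟧]
    (stdHereditaryOrder (PowerSeries.X : Fq⟦X⟧) f)ᵐᵒᵖ) := by
  have := Module.Free.of_basis B
  have := Module.Finite.of_basis B
  choose m hm1 hm2 using fun g : dieudonneEnd Fqd φ => exists_matrix_of_end hφ hd he hφe hB g.2
  have huniq : ∀ (g : dieudonneEnd Fqd φ)
      (n : Matrix (Σ i : Fin d, Fin (f i)) (Σ i : Fin d, Fin (f i)) Fq⟦X⟧),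
      (∀ b, g.1 (topVec Fq k Fqd e b) =
        ∑ a, algebraMap Fq⟦X⟧ k⟦X⟧ (n b a) • topVec Fq k Fqd e a) → m g = n := by
    intro g n hn
    refine Matrix.ext fun b a => ?_
    apply algebraMap_powerSeries_injective (k := k)
    exact congrFun (topVec_coeff_ext hB ((hm2 g b).symm.trans (hn b))) a
  let F : dieudonneEnd Fqd φ →ₐ[Fq⟦X⟧] (stdHereditaryOrder (PowerSeries.X : Fq⟦X⟧) f)ᵐᵒᵖ :=
    AlgHom.ofLinearMap
      { toFun := fun g => op ⟨m g, hm1 g⟩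
        map_add' := fun g h => by
          rw [← op_add]
          congr 1
          ext1
          refine huniq _ _ fun b => ?_
          change g.1 _ + h.1 _ = _
          rw [hm2, hm2, ← Finset.sum_add_distrib]
          refine Finset.sum_congr rfl fun a _ => ?_
          rw [← add_smul, ← map_add]
          rfl
        map_smul' := fun r g => by
          rw [RingHom.id_apply, ← op_smul]
          congr 1
          ext1
          refine huniq _ _ fun b => ?_
          change r • g.1 _ = _
          rw [hm2, ← algebraMap_smul k⟦X⟧ r, Finset.smul_sum]
          refine Finset.sum_congr rfl fun a _ => ?_
          rw [smul_smul, ← map_mul]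
          rfl }
      (by
        change op _ = op _
        congr 1
        ext1
        refine huniq _ _ fun b => ?_
        change topVec Fq k Fqd e b = ∑ a, algebraMap Fq⟦X⟧ k⟦X⟧
          ((1 : Matrix (Σ i : Fin d, Fin (f i)) (Σ i : Fin d, Fin (f i)) Fq⟦X⟧) b a) •
            topVec Fq k Fqd e a
        simp [Matrix.one_apply, apply_ite (algebraMap Fq⟦X⟧ k⟦X⟧), ite_smul])
      (fun g h => by
        change op _ = op _ * op _
        rw [← op_mul]
        congr 1
        ext1
        refine huniq _ _ fun b => ?_
        -- The scalars of h come out of g, so the matrix of h multiplies on the left: composition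
        -- reverses the product.
        change g.1 (h.1 _) = ∑ a, algebraMap Fq⟦X⟧ k⟦X⟧ ((m h * m g) b a) • _
        rw [hm2, map_sum]
        simp only [map_smul, hm2, Matrix.mul_apply, map_sum, Finset.sum_smul, Finset.smul_sum,
          smul_smul, map_mul]
        rw [Finset.sum_comm])
  have hF : ∀ g, F g = op ⟨m g, hm1 g⟩ := fun _ => rfl
  refine ⟨AlgEquiv.ofBijective F ⟨fun g h hgh => ?_, fun n => ?_⟩⟩
  · have hmm : m g = m h := by
      rw [hF, hF] at hgh
      exact congrArg Subtype.val (op_injective hgh)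
    have htop : ∀ b, g.1 (topVec Fq k Fqd e b) = h.1 (topVec Fq k Fqd e b) := fun b => by
      rw [hm2, hm2, hmm]
    have hpow : ∀ (g : dieudonneEnd Fqd φ) (t : ℕ) (x : M),
        g.1 ((piEnd Fq k M Fqd ^ t) x) = (piEnd Fq k M Fqd ^ t) (g.1 x) := by
      intro g t x
      induction t with
      | zero => rfl
      | succ t ih =>
        rw [pow_succ', Module.End.mul_apply, Module.End.mul_apply, piEnd_apply, g.2.2, ih,
          piEnd_apply]
    -- Cancelling the injective power of Π recovers the values on the e_b, which generate the basis
    -- under Π.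
    have he : ∀ b, g.1 (e b) = h.1 (e b) := fun b => by
      have h1 := htop b
      rw [topVec, hpow, hpow] at h1
      exact injective_pow_of_pow_eq_X (hd ▸ Module.finrank_pos) (piEnd_pow_eq hd) _ h1
    ext1
    refine B.ext fun ⟨t, b⟩ => ?_
    rw [hB, hpow, hpow, he]
  · obtain ⟨g, hg, hgn⟩ := exists_end_of_matrix hφ hd he hφe hB n.unop.2
    refine ⟨⟨g, hg⟩, ?_⟩
    rw [hF]
    apply unop_injective
    ext1
    exact huniq _ _ hgn

end EndRing

/-! ## Orders and the algebras they span -/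

section Denominators

variable {R K E A : Type*} [CommRing R] [Field K] [Algebra R K] [IsFractionRing R K]
  [Ring E] [Algebra R E] [Ring A] [Algebra R A] [Algebra K A] [IsScalarTower R K A]

/-- If `E` embeds into the `K`-algebra `A` such that each element of `A` has a multiple in `E`,
then `A` is the base change of `E`. -/
theorem nonempty_algEquiv_baseChange (ι : E →ₐ[R] A) (hι : Function.Injective ι)
    (hden : ∀ a : A, ∃ s ∈ nonZeroDivisors R, ∃ x, s • a = ι x) :
    Nonempty (K ⊗[R] E ≃ₐ[K] A) := by
  have hunit : ∀ s : nonZeroDivisors R, IsUnit (algebraMap R (Module.End R A) s) := fun s => by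
    have h := (IsLocalization.map_units K s).map (Algebra.lsmul R R A : K →ₐ[R] Module.End R A)
    rwa [AlgHom.commutes] at h
  -- Injectivity and bounded denominators make A the localization of the R-module E, so the
  -- base-change map is a linear bijection; it agrees with the algebra map built from the tensor
  -- product.
  have hloc : IsLocalizedModule (nonZeroDivisors R) ι.toLinearMap :=
    { map_units := hunit
      surj := fun a => by
        obtain ⟨s, hs, x, hx⟩ := hden a
        exact ⟨(x, ⟨s, hs⟩), hx⟩
      exists_of_eq := fun {x y} hxy => ⟨1, by rw [hι hxy]⟩ }
  have hbc := (isLocalizedModule_iff_isBaseChange (nonZeroDivisors R) K ι.toLinearMap).mp hloc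
  let F : K ⊗[R] E →ₐ[K] A :=
    Algebra.TensorProduct.lift (Algebra.ofId K A) ι fun a _ => Algebra.commutes a _
  have hF : ∀ z, F z = hbc.equiv z := by
    intro z
    induction z with
    | zero => simp
    | add x y hx hy => rw [map_add, map_add, hx, hy]
    | tmul c x =>
      rw [hbc.equiv_tmul, Algebra.smul_def]
      exact Algebra.TensorProduct.lift_tmul _ _ _ _ _
  refine ⟨AlgEquiv.ofBijective F ?_⟩
  rw [show (F : K ⊗[R] E → A) = hbc.equiv from funext hF]
  exact hbc.equiv.bijective

theorem isHereditaryOrder_range {H : Type*} [Ring H] [Algebra R H] (ι : E →ₐ[R] A)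
    (hι : Function.Injective ι) (hden : ∀ a : A, ∃ s ∈ nonZeroDivisors R, ∃ x, s • a = ι x)
    (ε : E ≃ₐ[R] H) (hfin : Module.Finite R H) (hH : IsHereditaryRing H) :
    IsHereditaryOrder R K ι.range where
  finite := Module.Finite.equiv (ε.symm.trans (AlgEquiv.ofInjective ι hι)).toLinearEquiv
  span_eq_top := by
    rw [eq_top_iff]
    intro a _
    obtain ⟨s, hs, x, hx⟩ := hden a
    have hs0 : algebraMap R K s ≠ 0 := (IsLocalization.map_units K ⟨s, hs⟩).ne_zero
    have h : a = (algebraMap R K s)⁻¹ • ι x := by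
      rw [← hx, ← algebraMap_smul K s a, smul_smul, inv_mul_cancel₀ hs0, one_smul]
    rw [h]
    exact Submodule.smul_mem _ _ (Submodule.subset_span ⟨x, rfl⟩)
  hereditary := hH.of_ringEquiv (ε.symm.trans (AlgEquiv.ofInjective ι hι)).toRingEquiv

end Denominators

/-! ### The standard order inside the matrix algebra over the fraction field. -/

section Matrices

variable {R K : Type*} [CommRing R] [IsDomain R] [Field K] [Algebra R K] [IsFractionRing R K]
  {ϖ : R} {d : ℕ} {f : Fin d → ℕ}

variable (K ϖ f) in
/-- The standard order inside the matrices over the fraction field. -/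
def stdHereditaryOrderToMatrix : stdHereditaryOrder ϖ f →ₐ[R]
    Matrix (Σ i : Fin d, Fin (f i)) (Σ i : Fin d, Fin (f i)) K :=
  (Algebra.ofId R K).mapMatrix.comp (stdHereditaryOrder ϖ f).val

theorem stdHereditaryOrderToMatrix_injective :
    Function.Injective (stdHereditaryOrderToMatrix K ϖ f) := by
  intro m n h
  ext a b
  exact IsFractionRing.injective R K (congrFun (congrFun h a) b)

theorem exists_smul_eq_stdHereditaryOrderToMatrix (hϖ : ϖ ≠ 0)
    (m : Matrix (Σ i : Fin d, Fin (f i)) (Σ i : Fin d, Fin (f i)) K) :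
    ∃ s ∈ nonZeroDivisors R, ∃ x, s • m = stdHereditaryOrderToMatrix K ϖ f x := by
  obtain ⟨s, hs⟩ := IsLocalization.exist_integer_multiples_of_finite (nonZeroDivisors R)
    fun p : (Σ i : Fin d, Fin (f i)) × (Σ i : Fin d, Fin (f i)) => m p.1 p.2
  choose r hr using hs
  -- Besides the common denominator s, one factor `ϖ` makes every entry divisible by `ϖ`, so the
  -- block condition holds automatically.
  refine ⟨ϖ * s, mul_mem (mem_nonZeroDivisors_of_ne_zero hϖ) s.2,
    ⟨Matrix.of fun a b => ϖ * r (a, b), ?_⟩, ?_⟩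
  · rw [mem_stdHereditaryOrder]
    intro a b _
    exact dvd_mul_right _ _
  · ext a b
    have h := hr (a, b)
    change (ϖ * s : R) • m a b = algebraMap R K (ϖ * r (a, b))
    rw [map_mul, h, mul_smul, Algebra.smul_def ϖ]

theorem stdHereditaryOrder_finite [IsNoetherianRing R] :
    Module.Finite R (stdHereditaryOrder ϖ f) :=
  inferInstanceAs (Module.Finite R (Subalgebra.toSubmodule (stdHereditaryOrder ϖ f)))

end Matrices

/-! ### Denominators of endomorphisms of N. -/

section Frac

variable {Fq k : Type*} [Field Fq] [Fintype Fq] [Field k] [Algebra Fq k] [IsAlgClosure Fq k]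
variable {M : Type*} [AddCommGroup M] [Module k⟦X⟧ M] [Module k M] [IsScalarTower k k⟦X⟧ M]
variable {Fqd : Type*} [Field Fqd] [Finite Fqd] [Algebra Fq Fqd] [Algebra Fqd k]
  [Module (MaxOrd Fq Fqd)ᵐᵒᵖ M]
variable {L : Type*} [Field L] [Algebra k⟦X⟧ L] [IsFractionRing k⟦X⟧ L]
variable {K : Type*} [Field K] [Algebra Fq⟦X⟧ K] [IsFractionRing Fq⟦X⟧ K]
  [Algebra Fq⟦X⟧ L] [IsScalarTower Fq⟦X⟧ k⟦X⟧ L] [Algebra K L] [IsScalarTower Fq⟦X⟧ K L]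
variable [Module Fq⟦X⟧ M] [IsScalarTower Fq⟦X⟧ k⟦X⟧ M]
  [IsScalarTower Fq⟦X⟧ (MaxOrd Fq Fqd)ᵐᵒᵖ M] [SMulCommClass (MaxOrd Fq Fqd)ᵐᵒᵖ k⟦X⟧ M]

theorem one_tmul_injective [Module.Free k⟦X⟧ M] :
    Function.Injective fun x : M => (1 : L) ⊗ₜ[k⟦X⟧] x := by
  intro x y hxy
  let B := Module.Free.chooseBasis k⟦X⟧ M
  apply B.repr.injective
  ext1 i
  have h := congrArg (fun z => (Algebra.TensorProduct.basis L B).repr z i) hxy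
  simp only [Algebra.TensorProduct.basis_repr_tmul, one_smul] at h
  exact IsFractionRing.injective k⟦X⟧ L (by simpa using h)

theorem coe_dieudonneEndBaseChange_tmul (φ : M →ₛₗ[frob Fq k] M) (g : dieudonneEnd Fqd φ) (c : L)
    (x : M) : (dieudonneEndBaseChange Fqd L K φ g).1 (c ⊗ₜ x) = c ⊗ₜ g.1 x := rfl

theorem dieudonneEndBaseChange_injective [Module.Free k⟦X⟧ M] (φ : M →ₛₗ[frob Fq k] M) :
    Function.Injective (dieudonneEndBaseChange Fqd L K φ) := by
  intro g h hgh
  ext x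
  apply one_tmul_injective (k := k) (L := L)
  simp only [← coe_dieudonneEndBaseChange_tmul (K := K), hgh]

/-- Every `L`-linear endomorphism of `L ⊗ M` maps `M` to itself after multiplication by a power
of `X`. -/
theorem exists_X_pow_smul_eq_tmul [Module.Free k⟦X⟧ M] [Module.Finite k⟦X⟧ M]
    (a : Module.End L (L ⊗[k⟦X⟧] M)) : ∃ (n : ℕ) (g : Module.End k⟦X⟧ M), ∀ x,
      (1 : L) ⊗ₜ[k⟦X⟧] g x = (PowerSeries.X ^ n : k⟦X⟧) • a ((1 : L) ⊗ₜ x) := by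
  let B := Module.Free.chooseBasis k⟦X⟧ M
  let BL := Algebra.TensorProduct.basis L B
  obtain ⟨s, hs⟩ := IsLocalization.exist_integer_multiples_of_finite (nonZeroDivisors k⟦X⟧)
    fun p : Module.Free.ChooseBasisIndex k⟦X⟧ M × Module.Free.ChooseBasisIndex k⟦X⟧ M =>
      BL.repr (a (BL p.1)) p.2
  -- Up to a unit the common denominator is a power of X. This matters because X, unlike a general
  -- element of k⟦X⟧, comes from R.
  obtain ⟨n, u, hu⟩ := IsDiscreteValuationRing.associated_pow_irreducible
    (nonZeroDivisors.ne_zero s.2) PowerSeries.X_irreducible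
  choose r hr using hs
  refine ⟨n, B.constr k⟦X⟧ fun i => ∑ j, (u * r (i, j)) • B j, fun x => ?_⟩
  let a' : M →ₗ[k⟦X⟧] L ⊗[k⟦X⟧] M :=
    (a.restrictScalars k⟦X⟧).comp (TensorProduct.mk k⟦X⟧ L M 1)
  suffices H : (TensorProduct.mk k⟦X⟧ L M 1).comp
      (B.constr k⟦X⟧ fun i => ∑ j, ((u : k⟦X⟧) * r (i, j)) • B j) =
      (PowerSeries.X ^ n : k⟦X⟧) • a' from LinearMap.congr_fun H x
  refine B.ext fun i => ?_
  rw [LinearMap.comp_apply, Module.Basis.constr_basis, map_sum, LinearMap.smul_apply]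
  change _ = (PowerSeries.X ^ n : k⟦X⟧) • a ((1 : L) ⊗ₜ B i)
  rw [← Algebra.TensorProduct.basis_apply B i, ← BL.sum_repr (a _), Finset.smul_sum]
  refine Finset.sum_congr rfl fun j _ => ?_
  have h := hr (i, j)
  rw [map_smul, TensorProduct.mk_apply, ← Algebra.TensorProduct.basis_apply B j, ← hu,
    mul_comm (s : k⟦X⟧), mul_smul, mul_smul]
  congr 1
  rw [← algebraMap_smul L (r (i, j)), h, smul_assoc]

/-- Since X is fixed by Frobenius and central for all actions, X^n a still commutes with φ and D.
Its restriction g to M inherits this because M embeds in N. -/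
theorem exists_smul_eq_dieudonneEndBaseChange [Module.Free k⟦X⟧ M] [Module.Finite k⟦X⟧ M]
    (φ : M →ₛₗ[frob Fq k] M) (a : dieudonneEndFrac Fqd L K φ) :
    ∃ s ∈ nonZeroDivisors Fq⟦X⟧, ∃ g, s • a = dieudonneEndBaseChange Fqd L K φ g := by
  obtain ⟨n, g, hg⟩ := exists_X_pow_smul_eq_tmul a.1
  have hinj := one_tmul_injective (k := k) (L := L) (M := M)
  have hφ1 : ∀ x : M, (1 : L) ⊗ₜ[k⟦X⟧] φ x = phiFrac L φ (1 ⊗ₜ x) := fun x => by simp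
  have hact : ∀ (δ : MaxOrd Fq Fqd) (x : M), (1 : L) ⊗ₜ[k⟦X⟧] (op δ • x) =
      actDiv M Fqd L K (1 ⊗ₜ op δ) (1 ⊗ₜ x) := fun δ x => by
    rw [actDiv_tmul, one_smul]
  refine ⟨PowerSeries.X ^ n, pow_mem (mem_nonZeroDivisors_of_ne_zero PowerSeries.X_ne_zero) n,
    ⟨g, fun x => hinj ?_, fun δ x => hinj ?_⟩, ?_⟩
  · change (1 : L) ⊗ₜ[k⟦X⟧] g (φ x) = 1 ⊗ₜ φ (g x)
    rw [hg, hφ1, hφ1, hg, a.2.1, map_smulₛₗ, map_pow, frob_X]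
  · change (1 : L) ⊗ₜ[k⟦X⟧] g (op δ • x) = 1 ⊗ₜ (op δ • g x)
    rw [hg, hact, hact, hg, a.2.2, LinearMap.map_smul_of_tower]
  · ext1
    refine LinearMap.ext fun z => ?_
    have hX : ∀ z : L ⊗[k⟦X⟧] M, ((PowerSeries.X ^ n : Fq⟦X⟧) • a).1 z =
        (PowerSeries.X ^ n : k⟦X⟧) • a.1 z := by
      intro z
      rw [← algebraMap_powerSeries_X (Fq := Fq) (k := k), ← map_pow, algebraMap_smul k⟦X⟧ _ (a.1 z)]
      rfl
    rw [hX]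
    induction z with
    | zero => simp
    | add x y hx hy => rw [map_add, map_add, smul_add, hx, hy]
    | tmul c x =>
      have hc : ∀ y : M, c ⊗ₜ[k⟦X⟧] y = c • ((1 : L) ⊗ₜ[k⟦X⟧] y) := fun y => by
        rw [TensorProduct.smul_tmul', smul_eq_mul, mul_one]
      rw [coe_dieudonneEndBaseChange_tmul, hc, hc, map_smul, hg, smul_comm]

end Frac

theorem mainTheorem3
    {Fq Fqd k : Type*} [Field Fq] [Fintype Fq] [Field Fqd] [Finite Fqd] [Field k]
    [Algebra Fq Fqd] [Algebra Fq k] [IsAlgClosure Fq k]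
    [Algebra Fqd k] [IsScalarTower Fq Fqd k]
    (d : ℕ) (hd : Module.finrank Fq Fqd = d)
    (K : Type*) [Field K] [Algebra Fq⟦X⟧ K] [IsFractionRing Fq⟦X⟧ K]
    (L : Type*) [Field L] [Algebra k⟦X⟧ L] [IsFractionRing k⟦X⟧ L]
    [Algebra Fq⟦X⟧ L] [IsScalarTower Fq⟦X⟧ k⟦X⟧ L] [Algebra K L] [IsScalarTower Fq⟦X⟧ K L]
    {M : Type*} [AddCommGroup M] [Module k⟦X⟧ M]
    [Module k M] [IsScalarTower k k⟦X⟧ M]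
    [Module Fq⟦X⟧ M] [IsScalarTower Fq⟦X⟧ k⟦X⟧ M]
    [Module (MaxOrd Fq Fqd)ᵐᵒᵖ M] [IsScalarTower Fq⟦X⟧ (MaxOrd Fq Fqd)ᵐᵒᵖ M]
    [SMulCommClass (MaxOrd Fq Fqd)ᵐᵒᵖ k⟦X⟧ M]
    (φ : M →ₛₗ[frob Fq k] M) (hM : IsDieudonneDModule Fqd φ) (hex : IsExceptional Fqd φ)
    (f : Fin d → ℕ) (hf : ∀ i : Fin d, f i = dieudonneType Fqd φ i) :
    ∑ i, f i = d ∧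
    Nonempty (dieudonneEnd Fqd φ ≃ₐ[Fq⟦X⟧]
      (stdHereditaryOrder (PowerSeries.X : Fq⟦X⟧) f)ᵐᵒᵖ) ∧
    Nonempty (dieudonneEnd Fqd φ ≃ₐ[Fq⟦X⟧]
      stdHereditaryOrder (PowerSeries.X : Fq⟦X⟧) (f ∘ Fin.rev)) ∧
    Function.Injective (dieudonneEndBaseChange Fqd L K φ) ∧
    IsHereditaryOrder Fq⟦X⟧ K (A := dieudonneEndFrac Fqd L K φ)
      (dieudonneEndBaseChange Fqd L K φ).range ∧
    Nonempty (dieudonneEndFrac Fqd L K φ ≃ₐ[K] Matrix (Fin d) (Fin d) K) := by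
  have := hM.free
  have := hM.finite
  have hdpos : 0 < d := hd ▸ Module.finrank_pos
  obtain ⟨e, B, he, hφe, hB⟩ := exists_adaptedBasis hM hex hd f hf
  have hsum : ∑ i, f i = d := by
    have h := Module.finrank_eq_card_basis B
    rw [hM.rank_eq, hd, Fintype.card_prod, Fintype.card_sigma, Fintype.card_fin, sq] at h
    simpa using (Nat.eq_of_mul_eq_mul_left hdpos h).symm
  obtain ⟨ε⟩ := nonempty_algEquiv_op hM.map_act hd he hφe hB
  let ε' := ε.trans (stdHereditaryOrderOp (PowerSeries.X : Fq⟦X⟧) f)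
  have hinj : Function.Injective (dieudonneEndBaseChange Fqd L K φ) :=
    dieudonneEndBaseChange_injective φ
  have hden := exists_smul_eq_dieudonneEndBaseChange (Fqd := Fqd) (L := L) (K := K) φ
  refine ⟨hsum, ⟨ε⟩, ⟨ε'⟩, hinj, isHereditaryOrder_range _ hinj hden ε' stdHereditaryOrder_finite
    (isHereditaryRing_stdHereditaryOrder PowerSeries.X_irreducible), ?_⟩
  -- Both End_D(N, φ) and the matrix algebra are the base change to K of End_𝒟(M, φ), the latter
  -- through its embedding as a standard order.
  obtain ⟨α⟩ := nonempty_algEquiv_baseChange (K := K) _ hinj hden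
  obtain ⟨β⟩ := nonempty_algEquiv_baseChange (K := K) (E := dieudonneEnd Fqd φ)
    ((stdHereditaryOrderToMatrix K (PowerSeries.X : Fq⟦X⟧) (f ∘ Fin.rev)).comp
      ε'.toAlgHom)
    ((stdHereditaryOrderToMatrix_injective (K := K)).comp ε'.injective) fun m => by
      obtain ⟨s, hs, x, hx⟩ := exists_smul_eq_stdHereditaryOrderToMatrix
        (ϖ := (PowerSeries.X : Fq⟦X⟧)) PowerSeries.X_ne_zero m
      exact ⟨s, hs, ε'.symm x, by rw [hx]; simp⟩
  have hcard : Fintype.card (Σ i : Fin d, Fin ((f ∘ Fin.rev) i)) = Fintype.card (Fin d) := by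
    rw [Fintype.card_sigma, Fintype.card_fin]
    simp only [Fintype.card_fin, Function.comp_apply]
    exact (Equiv.sum_comp Fin.revPerm f).trans hsum
  exact ⟨(α.symm.trans β).trans
    (Matrix.reindexAlgEquiv K K (Fintype.equivOfCardEq hcard))⟩
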